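/- Let $n,p\in\mathbb N$, let $\mathbf X\subset\mathbb R^n$ be compact, let $\lambda$ be the Lebesgue measure on $\mathbf X$, and let $\mu$ be a Borel probability measure on $\mathbb R^p$ with compact support $\mathbf\Omega$. Let $g_1,\dots,g_m\in\mathbb R[\mathbf x,\omega]$ be polynomials in $(\mathbf x,\omega)=(x_1,\dots,x_n,\omega_1,\dots,\omega_p)$ with $g_1(\mathbf x,\omega)=M-\Vert(\mathbf x,\omega)\Vert^2$ for some $M>0$, and let $$\mathbf K=\{(\mathbf x,\omega)\in\mathbf X\times\mathbf\Omega:\ g_j(\mathbf x,\omega)\ge 0,\ j=1,\dots,m\},\qquad \mathbf K_{\mathbf x}=\{\omega\in\mathbf\Omega:(\mathbf x,\omega)\in\mathbf K\}.$$ Assume that $\mathbf K$ and $(\mathbf X\times\mathbf\Omega)\setminus\mathbf K$ have nonempty interior (in $\mathbb R^{n+p}$). Let $$\rho=\sup\{\phi(\mathbf K):\ \phi\text{ a finite Borel measure on }\mathbf K,\ \phi\le\lambda\otimes\mu\}.$$ Put $d_j=\lceil\deg(g_j)/2\rceil$, $\lambda_\alpha=\int_{\mathbf X}\mathbf x^\alpha\,d\lambda$,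 $\mu_\beta=\int\omega^\beta\,d\mu$. For a real sequence $\mathbf y=(y_\gamma)_{\gamma\in\mathbb N^{n+p}}$ let $L_{\mathbf y}(\sum_\gamma f_\gamma(\mathbf x,\omega)^\gamma)=\sum_\gamma f_\gamma y_\gamma$, let $\mathbf M_k(\mathbf y)=(y_{\gamma+\delta})_{|\gamma|,|\delta|\le k}$, and for a polynomial $g$ let $\mathbf M_k(g\,\mathbf y)=(L_{\mathbf y}(g\cdot(\mathbf x,\omega)^{\gamma+\delta}))_{|\gamma|,|\delta|\le k}$ (an empty matrix if $k<0$). For $d\in\mathbb N$ consider the semidefinite program $$\rho_d=\sup_{\mathbf y,\mathbf z}\{\,y_0:\ y_{\alpha,\beta}+z_{\alpha,\beta}=\lambda_\alpha\mu_\beta\ \ (|\alpha|+|\beta|\le 2d),\ \ \mathbf M_d(\mathbf y)\succeq0,\ \mathbf M_d(\mathbf z)\succeq0,\ \mathbf M_{d-d_j}(g_j\,\mathbf y)\succeq0\ (j=1,\dots,m)\,\}$$ and its dual $$\rho^*_d=\inf_{q}\Big\{\int q\,d(\lambda\otimes\mu):\ q\in\mathbb R[\mathbf x,\omega]_{2d}\text{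 is a sum of squares},\ q-1=\sigma_0+\sum_{j=1}^m\sigma_j g_j\Big\},$$ where $\sigma_0,\dots,\sigma_m$ range over sums of squares of polynomials with $\deg\sigma_0\le 2d$ and $\deg\sigma_j\le 2(d-d_j)$ ($\sigma_j=0$ if $d<d_j$). Then, for every $d\in\mathbb N$: $\rho_d=\rho_d^*$; the dual has an optimal solution; and every optimal solution $p_d^*\in\mathbb R[\mathbf x,\omega]_{2d}$ of the dual satisfies $p^*_d\ge1$ on $\mathbf K$ and $\rho_d=\rho_d^*=\int p_d^*\,d(\lambda\otimes\mu)$, and the function $h_d^*(\mathbf x)=\int_{\mathbf\Omega}p_d^*(\mathbf x,\omega)\,\mu(d\omega)$ is a polynomial of degree at most $2d$ with $h_d^*(\mathbf x)\ge\mu(\mathbf K_{\mathbf x})$ for all $\mathbf x\in\mathbf X$ and $\rho_d=\int_{\mathbf X}h_d^*\,d\lambda$. Moreover $$\rho_d=\int_{\mathbf X}h^*_d\,d\lambda\ \longrightarrow\ \rho=\int_{\mathbf X}\mu(\mathbf K_{\mathbf x})\,\lambda(d\mathbf x)\qquad(d\to\infty).$$ -/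

import Mathlib

open MeasureTheory Filter Topology
open scoped ENNReal

noncomputable section

namespace ChanceConstraint

/-- The ring `ℝ[x, ω]`; the variables `Sum.inl i` are the `x i`, the variables `Sum.inr k` are
the `ω k`. -/
abbrev Poly (n p : ℕ) : Type := MvPolynomial (Fin n ⊕ Fin p) ℝ

/-- The multi-indices `(α, β) ∈ ℕ^(n+p)`. -/
abbrev Index (n p : ℕ) : Type := (Fin n ⊕ Fin p) →₀ ℕ

/-- The value `f(x, ω)`. -/
def evalAt {n p : ℕ} (f : Poly n p) (x : Fin n → ℝ) (w : Fin p → ℝ) : ℝ :=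
  MvPolynomial.eval (Sum.elim x w) f

/-- The set `K = {(x, ω) ∈ X × Ω : g_j(x, ω) ≥ 0 for all j}`. -/
def feasibleSet {n p : ℕ} {J : Type*} (X : Set (Fin n → ℝ)) (Om : Set (Fin p → ℝ))
    (g : J → Poly n p) : Set ((Fin n → ℝ) × (Fin p → ℝ)) :=
  {z | z.1 ∈ X ∧ z.2 ∈ Om ∧ ∀ j, 0 ≤ evalAt (g j) z.1 z.2}

/-- The section `K_x = {ω : (x, ω) ∈ K}`. -/
def fiber {n p : ℕ} (K : Set ((Fin n → ℝ) × (Fin p → ℝ))) (x : Fin n → ℝ) :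
    Set (Fin p → ℝ) :=
  {w | (x, w) ∈ K}

/-- The product `λ ⊗ μ` of the Lebesgue measure `λ` on `X` and of `μ`. -/
def refMeasure {n p : ℕ} (X : Set (Fin n → ℝ)) (μ : Measure (Fin p → ℝ)) :
    Measure ((Fin n → ℝ) × (Fin p → ℝ)) :=
  (volume.restrict X).prod μ

/-- The value of the infinite-dimensional linear program
`sup {φ(K) : φ a finite Borel measure on K, φ ≤ λ ⊗ μ}`. -/
def lpValue {n p : ℕ} (X : Set (Fin n → ℝ)) (μ : Measure (Fin p → ℝ))
    (K : Set ((Fin n → ℝ) × (Fin p → ℝ))) : ℝ≥0∞ :=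
  sSup {r | ∃ φ : Measure ((Fin n → ℝ) × (Fin p → ℝ)),
    IsFiniteMeasure φ ∧ φ Kᶜ = 0 ∧ φ ≤ refMeasure X μ ∧ r = φ K}

/-- The number `λ_α · μ_β`, with `λ_α = ∫_X x^α dλ` and `μ_β = ∫ ω^β dμ`. -/
def momentProd {n p : ℕ} (X : Set (Fin n → ℝ)) (μ : Measure (Fin p → ℝ))
    (γ : Index n p) : ℝ :=
  (∫ x in X, ∏ i, x i ^ γ (Sum.inl i)) * ∫ w, ∏ k, w k ^ γ (Sum.inr k) ∂μ

/-- The Riesz functional `L_y(f) = ∑ f_γ y_γ`. -/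
def riesz {n p : ℕ} (y : Index n p → ℝ) (f : Poly n p) : ℝ :=
  ∑ γ ∈ f.support, f.coeff γ * y γ

/-- The moment matrix `M_k(y)`, indexed by the multi-indices of degree at most `k`. -/
def momentMatrix {n p : ℕ} (k : ℤ) (y : Index n p → ℝ) :
    Matrix {α : Index n p // (α.degree : ℤ) ≤ k} {α : Index n p // (α.degree : ℤ) ≤ k} ℝ :=
  Matrix.of fun α β => y (α.1 + β.1)

/-- The localizing matrix `M_k(g y)`, with entries `L_y(g · (x,ω)^(α+β))`; it is empty when
`k < 0`. -/
def localizingMatrix {n p : ℕ} (k : ℤ) (g : Poly n p) (y : Index n p → ℝ) :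
    Matrix {α : Index n p // (α.degree : ℤ) ≤ k} {α : Index n p // (α.degree : ℤ) ≤ k} ℝ :=
  Matrix.of fun α β => riesz y (g * MvPolynomial.monomial (α.1 + β.1) 1)

/-- `⌈deg(g) / 2⌉`. -/
def halfDeg {n p : ℕ} (g : Poly n p) : ℕ := (g.totalDegree + 1) / 2

/-- Feasibility of `(y, z)` in the moment relaxation of order `d`. -/
structure MomentFeasible {n p : ℕ} {J : Type*} (X : Set (Fin n → ℝ))
    (μ : Measure (Fin p → ℝ)) (g : J → Poly n p) (d : ℕ) (y z : Index n p → ℝ) : Prop where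
  sum_eq : ∀ γ : Index n p, γ.degree ≤ 2 * d → y γ + z γ = momentProd X μ γ
  psd_y : (momentMatrix d y).PosSemidef
  psd_z : (momentMatrix d z).PosSemidef
  psd_loc : ∀ j, (localizingMatrix ((d : ℤ) - halfDeg (g j)) (g j) y).PosSemidef

/-- The optimal value `ρ_d` of the moment relaxation of order `d`. -/
def momentValue {n p : ℕ} {J : Type*} (X : Set (Fin n → ℝ)) (μ : Measure (Fin p → ℝ))
    (g : J → Poly n p) (d : ℕ) : EReal :=
  sSup {r | ∃ y z, MomentFeasible X μ g d y z ∧ r = ((y 0 : ℝ) : EReal)}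

/-- Feasibility of `q` in the dual semidefinite program of order `d`: `q` is a sum of squares of
degree at most `2d`, and `q ≥ 1` on `K` is certified by `q - 1 = σ₀ + ∑ j, σ_j g_j` with sums of
squares `σ₀` of degree at most `2d` and `σ_j` of degree at most `2 (d - ⌈deg(g_j)/2⌉)`
(no multiplier, that is `σ_j = 0`, when this number is negative). -/
structure SosFeasible {n p : ℕ} {J : Type*} [Fintype J] (g : J → Poly n p) (d : ℕ)
    (q : Poly n p) : Prop where
  degree_le : q.totalDegree ≤ 2 * d
  isSumSq : IsSumSq q
  cert : ∃ (σ₀ : Poly n p) (σ : J → Poly n p),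
    IsSumSq σ₀ ∧ σ₀.totalDegree ≤ 2 * d ∧
    (∀ j, IsSumSq (σ j) ∧ (σ j = 0 ∨ (σ j).totalDegree + 2 * halfDeg (g j) ≤ 2 * d)) ∧
    q - 1 = σ₀ + ∑ j, σ j * g j

/-- The objective `∫ q d(λ ⊗ μ)` of the dual. -/
def sosObjective {n p : ℕ} (X : Set (Fin n → ℝ)) (μ : Measure (Fin p → ℝ))
    (q : Poly n p) : ℝ :=
  ∫ z, evalAt q z.1 z.2 ∂(refMeasure X μ)

/-- The optimal value `ρ*_d` of the dual semidefinite program of order `d`. -/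
def sosValue {n p : ℕ} {J : Type*} [Fintype J] (X : Set (Fin n → ℝ))
    (μ : Measure (Fin p → ℝ)) (g : J → Poly n p) (d : ℕ) : EReal :=
  sInf {r | ∃ q, SosFeasible g d q ∧ r = ((sosObjective X μ q : ℝ) : EReal)}

/-- `q` is an optimal solution of the dual semidefinite program of order `d`. -/
def IsSosOptimal {n p : ℕ} {J : Type*} [Fintype J] (X : Set (Fin n → ℝ))
    (μ : Measure (Fin p → ℝ)) (g : J → Poly n p) (d : ℕ) (q : Poly n p) : Prop :=
  SosFeasible g d q ∧ ∀ q', SosFeasible g d q' → sosObjective X μ q ≤ sosObjective X μ q'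

end ChanceConstraint

end

/-! Duality. Positive semidefiniteness of the moment and localizing matrices says that the Riesz
functionals are nonnegative on squares and on `g j * f * f`. Weak duality follows by applying `y` to
`q - 1` and `z` to `q`. For the converse, let `m` be the moments of `λ ⊗ μ`. The pairs `(q - r, L_m
q + t)`, with `q` a sum of squares, `r` in the truncated quadratic module and `t ≥ 0`, form a convex
cone, and `(1, r)` lies in it exactly when some dual feasible `q` has objective at most `r`
(`mem_programCone_iff`). The cone is closed because it is generated by a compact set on which a
linear functional is positive; that functional comes from the moments of `λ ⊗ μ` restricted to `K`,
and strict positivity is where the two interior conditions enter. Closedness gives a dual minimizer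
(`StrictlyFeasible.exists_isMin`), and separating `(1, r)` from the cone for `r` below the minimum
gives moment solutions of value above `r` (`StrictlyFeasible.exists_momentFeasible`).

Convergence. A feasible `q` dominates the indicator of `K`, so `ρ_d ≥ ρ`. For the upper bound, `δ /
(δ + violation)` tends to the indicator of `K` on `X ×ˢ Om`, and it equals `1 + ∑ g_j Q_j` with
continuous `Q_j ≥ 0`. Replacing it and the `Q_j` by squares of polynomials leaves an error
polynomial that is uniformly small on `X ×ˢ Om`. The constraint on `z` makes `L_y (f * f) ≤ ∫ f²`,
which controls `L_y` of that error directly and takes the place of a Positivstellensatz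
(`eventually_momentFeasible_le`). -/

namespace ChanceConstraint

open MvPolynomial

/-! ### Riesz functionals and semidefiniteness of localizing matrices. -/

section Riesz

variable {n p : ℕ}

/-- The Riesz functional as a linear map. -/
noncomputable def rieszLin (y : Index n p → ℝ) : Poly n p →ₗ[ℝ] ℝ :=
  (basisMonomials (Fin n ⊕ Fin p) ℝ).constr ℝ y

lemma rieszLin_monomial (y : Index n p → ℝ) (γ : Index n p) (c : ℝ) :
    rieszLin y (monomial γ c) = c * y γ := by
  have h : monomial γ c = c • basisMonomials (Fin n ⊕ Fin p) ℝ γ := by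
    simp [smul_monomial]
  rw [h, map_smul, rieszLin, Module.Basis.constr_basis, smul_eq_mul]

lemma riesz_eq (y : Index n p → ℝ) (f : Poly n p) : riesz y f = rieszLin y f := by
  conv_rhs => rw [← support_sum_monomial_coeff f, map_sum]
  exact Finset.sum_congr rfl fun γ _ ↦ (rieszLin_monomial y γ _).symm

lemma rieszLin_one (y : Index n p → ℝ) : rieszLin y 1 = y 0 := by
  simpa using rieszLin_monomial y 0 1

lemma momentMatrix_eq (k : ℤ) (y : Index n p → ℝ) :
    momentMatrix k y = localizingMatrix k 1 y := by
  ext α β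
  simp [momentMatrix, localizingMatrix, riesz_eq, rieszLin_monomial]

lemma localizing_quadForm (k : ℤ) (g : Poly n p) (y : Index n p → ℝ)
    (x : {α : Index n p // (α.degree : ℤ) ≤ k} →₀ ℝ) :
    (x.sum fun i xi ↦ x.sum fun j xj ↦ star xi * localizingMatrix k g y i j * xj) =
      rieszLin y (g * (x.sum fun i xi ↦ monomial i.1 xi) * (x.sum fun i xi ↦ monomial i.1 xi)) := by
  simp only [Finsupp.sum, Finset.mul_sum, Finset.sum_mul, map_sum, star_trivial]
  rw [Finset.sum_comm]
  refine Finset.sum_congr rfl fun i _ ↦ Finset.sum_congr rfl fun j _ ↦ ?_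
  rw [localizingMatrix, Matrix.of_apply, riesz_eq, mul_assoc g, monomial_mul]
  have : monomial (j.1 + i.1) (x j * x i) = (x j * x i) • monomial (j.1 + i.1) (1 : ℝ) := by
    rw [smul_monomial]; simp
  rw [this, mul_smul_comm, map_smul, smul_eq_mul]
  ring

/-- A vector indexed by multi-indices of degree at most `k` is the coefficient vector of a
polynomial `f`, and its quadratic form is `L_y (g f²)`. The alternative `f = 0` matters for `k < 0`,
where the matrix is empty. -/
lemma posSemidef_localizing_iff (k : ℤ) (g : Poly n p) (y : Index n p → ℝ) :
    (localizingMatrix k g y).PosSemidef ↔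
      ∀ f : Poly n p, (f = 0 ∨ (f.totalDegree : ℤ) ≤ k) → 0 ≤ rieszLin y (g * f * f) := by
  constructor
  · rintro ⟨-, h⟩ f hf
    have hdeg : ∀ γ ∈ f.support, (γ.degree : ℤ) ≤ k := by
      intro γ hγ
      rcases hf with rfl | hf
      · simp at hγ
      · exact le_trans (by exact_mod_cast le_totalDegree hγ) hf
    classical
    let x : {α : Index n p // (α.degree : ℤ) ≤ k} →₀ ℝ :=
      Finsupp.onFinset (f.support.subtype _) (fun i ↦ f.coeff i.1) (by simp)
    have hx : (x.sum fun i xi ↦ monomial i.1 xi) = f := by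
      rw [Finsupp.sum_of_support_subset (s := f.support.subtype _) _
        Finsupp.support_onFinset_subset _ (by simp)]
      simp only [Finsupp.onFinset_apply]
      conv_rhs => rw [← support_sum_monomial_coeff f]
      exact Finset.sum_subtype_of_mem (fun γ ↦ monomial γ (f.coeff γ)) hdeg
    have := h x
    rwa [localizing_quadForm, hx] at this
  · intro h
    refine ⟨?_, fun x ↦ ?_⟩
    · ext α β
      simp [localizingMatrix, add_comm]
    · rw [localizing_quadForm]
      apply h
      by_cases hx : x.support = ∅
      · left
        simp [Finsupp.sum, hx]
      · right
        obtain ⟨a, -⟩ := Finset.nonempty_iff_ne_empty.2 hx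
        have hk : 0 ≤ k := le_trans (by positivity) a.2
        lift k to ℕ using hk
        norm_cast
        refine totalDegree_finsetSum_le fun i _ ↦ ?_
        refine (totalDegree_monomial_le _ _).trans ?_
        exact_mod_cast i.2

end Riesz

/-! ### Degree bounds for the terms of a sum of squares. -/

section SumSq

variable {σ : Type*}

lemma totalDegree_sub_homogeneousComponent_lt (a : MvPolynomial σ ℝ) {N : ℕ} (hN : 0 < N)
    (ha : a.totalDegree ≤ N) : (a - homogeneousComponent N a).totalDegree < N := by
  refine (Finset.sup_lt_iff (by simpa using hN)).2 fun γ hγ ↦ ?_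
  rw [mem_support_iff, coeff_sub, coeff_homogeneousComponent] at hγ
  have h1 : a.coeff γ ≠ 0 := by
    rintro h; simp [h] at hγ
  have h2 : γ.degree ≤ N := (le_totalDegree (mem_support_iff.2 h1)).trans ha
  have h3 : γ.degree ≠ N := by
    rintro h; simp [h] at hγ
  exact lt_of_le_of_ne h2 h3

lemma homogeneousComponent_mul_self (a : MvPolynomial σ ℝ) {N : ℕ} (hN : 0 < N)
    (ha : a.totalDegree ≤ N) :
    homogeneousComponent (2 * N) (a * a) =
      homogeneousComponent N a * homogeneousComponent N a := by
  set h := homogeneousComponent N a with hh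
  have e : a * a = h * h + (a - h) * (a + h) := by ring
  have hlt := totalDegree_sub_homogeneousComponent_lt a hN ha
  have hhom : h.IsHomogeneous N := homogeneousComponent_isHomogeneous N a
  have hle : (a + h).totalDegree ≤ N :=
    (totalDegree_add _ _).trans (max_le ha hhom.totalDegree_le)
  rw [e, map_add, homogeneousComponent_eq_zero (2 * N) ((a - h) * (a + h))
    ((totalDegree_mul _ _).trans_lt (by rw [two_mul]; exact add_lt_add_of_lt_of_le hlt hle)),
    add_zero]
  apply homogeneousComponent_eq_self
  rw [two_mul]
  exact hhom.mul hhom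

lemma eq_zero_of_sum_mul_self_eq_zero (l : List (MvPolynomial σ ℝ))
    (h : (l.map fun a ↦ a * a).sum = 0) : ∀ a ∈ l, a = 0 := by
  intro a ha
  refine MvPolynomial.funext fun x ↦ ?_
  have h1 : ((l.map fun a ↦ a * a).map (eval x)).sum = 0 := by
    rw [← map_list_sum, h, map_zero]
  rw [List.map_map] at h1
  have h2 : eval x a * eval x a ≤ (l.map (eval x ∘ fun a ↦ a * a)).sum := by
    refine List.single_le_sum ?_ _ (List.mem_map.2 ⟨a, ha, by simp⟩)
    intro b hb
    obtain ⟨c, -, rfl⟩ := List.mem_map.1 hb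
    simpa using mul_self_nonneg (eval x c)
  rw [map_zero]
  exact mul_self_eq_zero.1 (le_antisymm (h2.trans h1.le) (mul_self_nonneg _))

/-- Leading forms of real squares cannot cancel: if all degrees are at most `N > k`, the squares of
the components of degree `N` add up to the component of degree `2 * N` of the sum, which is zero, so
each of them vanishes. This lowers the excess `j` over `k` one step at a time. -/
lemma totalDegree_le_of_sum_mul_self (l : List (MvPolynomial σ ℝ)) (k : ℕ)
    (h : (l.map fun a ↦ a * a).sum.totalDegree ≤ 2 * k) : ∀ a ∈ l, a.totalDegree ≤ k := by
  have key : ∀ j, (∀ a ∈ l, a.totalDegree ≤ k + j) → ∀ a ∈ l, a.totalDegree ≤ k := by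
    intro j
    induction j with
    | zero => simp
    | succ j ih =>
      intro hl
      apply ih
      have h0 : ((l.map (homogeneousComponent (k + (j + 1)))).map fun a ↦ a * a).sum = 0 := by
        rw [← homogeneousComponent_eq_zero (2 * (k + (j + 1))) (l.map fun a ↦ a * a).sum (by omega),
          map_list_sum, List.map_map, List.map_map]
        refine congrArg List.sum (List.map_congr_left fun a ha ↦ ?_)
        exact (homogeneousComponent_mul_self a (by omega) (hl a ha)).symm
      intro a ha
      have := eq_zero_of_sum_mul_self_eq_zero _ h0 _ (List.mem_map.2 ⟨a, ha, rfl⟩)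
      have hlt := totalDegree_sub_homogeneousComponent_lt a (by omega) (hl a ha)
      rw [this, sub_zero] at hlt
      omega
  -- The sum of all the degrees is a crude initial excess that works for every term.
  refine key (l.map totalDegree).sum fun a ha ↦ ?_
  have := List.single_le_sum (l := l.map totalDegree) (by simp) _ (List.mem_map.2 ⟨a, ha, rfl⟩)
  omega

lemma exists_list_of_isSumSq {s : MvPolynomial σ ℝ} (hs : IsSumSq s) :
    ∃ l : List (MvPolynomial σ ℝ), s = (l.map fun a ↦ a * a).sum := by
  induction hs with
  | zero => exact ⟨[], by simp⟩
  | sq_add a _ ih =>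
    obtain ⟨l, rfl⟩ := ih
    exact ⟨a :: l, by simp⟩

/-- Induction principle for sums of squares of degree at most `2 * k`. -/
lemma isSumSq_induction {k : ℕ} {P : MvPolynomial σ ℝ → Prop} (zero : P 0)
    (add : ∀ a b, P a → P b → P (a + b)) (sq : ∀ a, a.totalDegree ≤ k → P (a * a))
    {s : MvPolynomial σ ℝ} (hs : IsSumSq s) (hd : s.totalDegree ≤ 2 * k) : P s := by
  obtain ⟨l, rfl⟩ := exists_list_of_isSumSq hs
  have hl := totalDegree_le_of_sum_mul_self l k hd
  clear hs hd
  induction l with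
  | nil => simpa
  | cons a l ih =>
    simp only [List.map_cons, List.sum_cons]
    exact add _ _ (sq a (hl a (by simp))) (ih fun b hb ↦ hl b (by simp [hb]))

lemma isSumSq_smul {s : MvPolynomial σ ℝ} (hs : IsSumSq s) {c : ℝ} (hc : 0 ≤ c) :
    IsSumSq (c • s) := by
  induction hs with
  | zero => simp [IsSumSq.zero]
  | sq_add a _ ih =>
    have : c • (a * a) = (Real.sqrt c • a) * (Real.sqrt c • a) := by
      rw [smul_mul_smul_comm, Real.mul_self_sqrt hc]
    rw [smul_add, this]
    exact .sq_add _ ih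

end SumSq

end ChanceConstraint

/-! ### Closed conic hulls in finite dimension. -/

section Cone

variable {E : Type*} [NormedAddCommGroup E] [NormedSpace ℝ E] [FiniteDimensional ℝ E]

/-- By Carathéodory, at most `finrank + 1` points suffice for each convex combination
(`Finset.range` excludes its bound, hence `+ 2`), so the hull is a finite union of continuous images
of compact sets. -/
lemma IsCompact.convexHull_of_finiteDimensional {s : Set E} (hs : IsCompact s) :
    IsCompact (convexHull ℝ s) := by
  have key : convexHull ℝ s = ⋃ k ∈ Finset.range (Module.finrank ℝ E + 2),
      (fun q : (Fin k → ℝ) × (Fin k → E) ↦ ∑ i, q.1 i • q.2 i) ''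
        (stdSimplex ℝ (Fin k) ×ˢ Set.univ.pi fun _ ↦ s) := by
    apply Set.Subset.antisymm
    · intro x hx
      obtain ⟨ι, hι, z, w, hz, hind, hw, hsum, hx⟩ := eq_pos_convex_span_of_mem_convexHull hx
      have hcard := hind.card_le_finrank_succ
      have hle : Module.finrank ℝ (vectorSpan ℝ (Set.range z)) ≤ Module.finrank ℝ E :=
        Submodule.finrank_le _
      let e := Fintype.equivFin ι
      refine Set.mem_biUnion (x := Fintype.card ι)
        (by simp only [Finset.coe_range, Set.mem_Iio]; omega)
        ⟨(w ∘ e.symm, z ∘ e.symm), ⟨⟨fun i ↦ (hw _).le, ?_⟩, fun i _ ↦ hz ⟨_, rfl⟩⟩, ?_⟩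
      · rw [← hsum]
        exact e.symm.sum_comp w
      · rw [← hx]
        exact e.symm.sum_comp fun i ↦ w i • z i
    · refine Set.iUnion₂_subset fun k _ ↦ ?_
      rintro _ ⟨⟨w, z⟩, ⟨hw, hz⟩, rfl⟩
      exact (convex_convexHull ℝ s).sum_mem (fun i _ ↦ hw.1 i) hw.2
        fun i _ ↦ subset_convexHull ℝ s (hz i trivial)
  rw [key]
  refine (Finset.range _).isCompact_biUnion fun k _ ↦ ?_
  refine ((isCompact_stdSimplex ℝ (Fin k)).prod (isCompact_univ_pi fun _ ↦ hs)).image ?_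
  fun_prop

/-- In finite dimension, the conic hull of a compact set on which some linear functional is
positive is closed. -/
lemma IsCompact.isClosed_hull {s : Set E} (hs : IsCompact s) (hne : s.Nonempty)
    (l : E →ₗ[ℝ] ℝ) (hl : ∀ x ∈ s, 0 < l x) :
    IsClosed (PointedCone.hull ℝ s : Set E) := by
  have hlc : Continuous l := l.continuous_of_finiteDimensional
  have hT := hs.convexHull_of_finiteDimensional
  obtain ⟨x₀, hx₀, hmin⟩ := hT.exists_isMinOn (hne.convexHull) hlc.continuousOn
  have hpos : ∀ x ∈ convexHull ℝ s, 0 < l x := by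
    intro x hx
    have : convexHull ℝ s ⊆ {x | 0 < l x} :=
      convexHull_min hl (convex_halfSpace_gt l.isLinear 0)
    exact this hx
  have hc := hpos x₀ hx₀
  have hrep : ∀ x, x ∈ PointedCone.hull ℝ s ↔ ∃ t : ℝ, 0 ≤ t ∧ ∃ v ∈ convexHull ℝ s, x = t • v := by
    intro x
    constructor
    · intro hx
      induction hx using Submodule.span_induction with
      | mem x hx => exact ⟨1, zero_le_one, x, subset_convexHull ℝ s hx, by simp⟩
      | zero => exact ⟨0, le_rfl, x₀, hx₀, by simp⟩
      | smul c x _ ih =>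
        obtain ⟨t, ht, v, hv, rfl⟩ := ih
        refine ⟨c * t, mul_nonneg c.2 ht, v, hv, ?_⟩
        rw [mul_smul]; rfl
      | add x y _ _ ihx ihy =>
        obtain ⟨t, ht, v, hv, rfl⟩ := ihx
        obtain ⟨u, hu, w, hw, rfl⟩ := ihy
        rcases eq_or_lt_of_le (add_nonneg ht hu) with h | h
        · have ht0 : t = 0 := by linarith
          have hu0 : u = 0 := by linarith
          exact ⟨0, le_rfl, x₀, hx₀, by simp [ht0, hu0]⟩
        · refine ⟨t + u, h.le, (t / (t + u)) • v + (u / (t + u)) • w,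
            convex_convexHull ℝ s hv hw (by positivity) (by positivity) (by field_simp), ?_⟩
          rw [smul_add, smul_smul, smul_smul, mul_div_cancel₀ _ h.ne', mul_div_cancel₀ _ h.ne']
    · rintro ⟨t, ht, v, hv, rfl⟩
      have hv' : v ∈ (PointedCone.hull ℝ s : Set E) :=
        convexHull_min PointedCone.subset_hull (PointedCone.convex _) hv
      exact PointedCone.smul_mem _ ht hv'
  refine IsSeqClosed.isClosed fun u x hu hux ↦ ?_
  -- Along a convergent sequence `l` is bounded by some `R`, while `l ≥ l x₀ > 0` on the convex
  -- hull. The scalars are therefore at most `R / l x₀`, which confines the sequence to a compact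
  -- set.
  obtain ⟨R, hR⟩ := ((hlc.tendsto x).comp hux).bddAbove_range
  have hcomp : IsCompact ((fun q : ℝ × E ↦ q.1 • q.2) ''
      (Set.Icc 0 (R / l x₀) ×ˢ convexHull ℝ s)) :=
    (isCompact_Icc.prod hT).image (by fun_prop)
  have hmem : ∀ k, u k ∈ (fun q : ℝ × E ↦ q.1 • q.2) ''
      (Set.Icc 0 (R / l x₀) ×ˢ convexHull ℝ s) := by
    intro k
    obtain ⟨t, ht, v, hv, hk⟩ := (hrep _).1 (hu k)
    refine ⟨(t, v), ⟨⟨ht, ?_⟩, hv⟩, hk.symm⟩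
    rw [le_div_iff₀ hc]
    calc t * l x₀ ≤ t * l v := mul_le_mul_of_nonneg_left (hmin hv) ht
      _ = l (u k) := by rw [hk, map_smul, smul_eq_mul]
      _ ≤ R := hR ⟨k, rfl⟩
  obtain ⟨⟨t, v⟩, ⟨ht, hv⟩, rfl⟩ := hcomp.isClosed.mem_of_tendsto hux (Eventually.of_forall hmem)
  exact (hrep _).2 ⟨t, ht.1, v, hv, rfl⟩

end Cone

/-! ### Polynomials as coefficient vectors, normalized squares and truncated quadratic modules. -/

namespace ChanceConstraint

open MvPolynomial

variable {n p : ℕ}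

noncomputable instance fintypeIndexLE (k : ℕ) : Fintype {γ : Index n p // γ.degree ≤ k} :=
  (Finsupp.finite_of_degree_le k).fintype

/-- The coefficients of a polynomial up to degree `k`. -/
noncomputable def truncCoeff (n p k : ℕ) :
    Poly n p →ₗ[ℝ] ({γ : Index n p // γ.degree ≤ k} → ℝ) :=
  LinearMap.pi fun γ ↦ lcoeff ℝ γ.1

lemma truncCoeff_apply (k : ℕ) (f : Poly n p) (γ : {γ : Index n p // γ.degree ≤ k}) :
    truncCoeff n p k f γ = f.coeff γ.1 := rfl

lemma eq_zero_of_truncCoeff_eq_zero {k : ℕ} {f : Poly n p} (hf : f.totalDegree ≤ k)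
    (h : truncCoeff n p k f = 0) : f = 0 := by
  ext γ
  by_cases hγ : γ.degree ≤ k
  · simpa [truncCoeff_apply] using congrFun h ⟨γ, hγ⟩
  · by_contra hne
    exact hγ ((le_totalDegree (mem_support_iff.2 hne)).trans hf)

/-- The polynomial with given coefficients up to degree `k`. -/
noncomputable def ofCoeff (n p k : ℕ) :
    ({γ : Index n p // γ.degree ≤ k} → ℝ) →ₗ[ℝ] Poly n p :=
  ∑ γ, (monomial γ.1).comp (LinearMap.proj γ)

lemma ofCoeff_apply (k : ℕ) (c : {γ : Index n p // γ.degree ≤ k} → ℝ) :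
    ofCoeff n p k c = ∑ γ, monomial γ.1 (c γ) := by
  simp [ofCoeff]

lemma truncCoeff_ofCoeff (k : ℕ) (c : {γ : Index n p // γ.degree ≤ k} → ℝ) :
    truncCoeff n p k (ofCoeff n p k c) = c := by
  classical
  ext γ
  rw [truncCoeff_apply, ofCoeff_apply, coeff_sum, Finset.sum_eq_single γ]
  · simp
  · intro β _ hβ
    rw [coeff_monomial, if_neg fun h ↦ hβ (Subtype.ext h)]
  · simp

lemma totalDegree_ofCoeff_le (k : ℕ) (c : {γ : Index n p // γ.degree ≤ k} → ℝ) :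
    (ofCoeff n p k c).totalDegree ≤ k := by
  rw [ofCoeff_apply]
  exact totalDegree_finsetSum_le fun i _ ↦ (totalDegree_monomial_le _ _).trans i.2

lemma ofCoeff_truncCoeff {k : ℕ} {f : Poly n p} (hf : f.totalDegree ≤ k) :
    ofCoeff n p k (truncCoeff n p k f) = f := by
  rw [← sub_eq_zero]
  refine eq_zero_of_truncCoeff_eq_zero (k := k)
    ((totalDegree_sub _ _).trans (max_le (totalDegree_ofCoeff_le _ _) hf)) ?_
  rw [map_sub, truncCoeff_ofCoeff, sub_self]

lemma rieszLin_eq_sum (y : Index n p → ℝ) {k : ℕ} {f : Poly n p} (hf : f.totalDegree ≤ k) :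
    rieszLin y f = ∑ γ, truncCoeff n p k f γ * y γ.1 := by
  conv_lhs => rw [← ofCoeff_truncCoeff hf, ofCoeff_apply, map_sum]
  simp [rieszLin_monomial]

section Squares

variable {F : Type*} [NormedAddCommGroup F] [NormedSpace ℝ F]

/-- The images under a linear map of the squares of the normalized polynomials of degree
at most `k`. -/
def squareImage (Ψ : Poly n p →ₗ[ℝ] F) (k : ℕ) : Set F :=
  (fun c ↦ Ψ (ofCoeff n p k c * ofCoeff n p k c)) '' Metric.sphere 0 1

/-- The map `c ↦ Ψ (f_c²)` is a quadratic polynomial in finitely many coordinates, hence continuous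
whatever the linear map `Ψ` is. -/
lemma isCompact_squareImage (Ψ : Poly n p →ₗ[ℝ] F) (k : ℕ) : IsCompact (squareImage Ψ k) := by
  refine (isCompact_sphere _ _).image ?_
  have : (fun c ↦ Ψ (ofCoeff n p k c * ofCoeff n p k c)) =
      fun c ↦ ∑ α, ∑ β, (c α * c β) • Ψ (monomial α.1 1 * monomial β.1 1) := by
    ext c
    have hm : ∀ (γ : Index n p) (t : ℝ), monomial γ t = t • monomial γ (1 : ℝ) := by
      intro γ t; rw [smul_monomial]; simp
    rw [ofCoeff_apply, Finset.sum_mul_sum, map_sum]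
    refine Finset.sum_congr rfl fun α _ ↦ ?_
    rw [map_sum]
    refine Finset.sum_congr rfl fun β _ ↦ ?_
    rw [hm α.1 (c α), hm β.1 (c β), smul_mul_smul_comm, map_smul]
  rw [this]
  fun_prop

lemma exists_of_mem_squareImage {Ψ : Poly n p →ₗ[ℝ] F} {k : ℕ} {x : F}
    (hx : x ∈ squareImage Ψ k) :
    ∃ f : Poly n p, f ≠ 0 ∧ f.totalDegree ≤ k ∧ x = Ψ (f * f) := by
  obtain ⟨c, hc, rfl⟩ := hx
  refine ⟨ofCoeff n p k c, fun h ↦ ?_, totalDegree_ofCoeff_le _ _, rfl⟩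
  have h0 : c = 0 := by rw [← truncCoeff_ofCoeff k c, h, map_zero]
  simp [h0] at hc

/-- Normalizing the coefficients divides `f * f` by the positive number `‖c‖ ^ 2`, which a cone does
not notice. -/
lemma map_mul_self_mem_hull {Ψ : Poly n p →ₗ[ℝ] F} {k : ℕ} {S : Set F}
    (hS : squareImage Ψ k ⊆ S) {f : Poly n p} (hf : f.totalDegree ≤ k) :
    Ψ (f * f) ∈ PointedCone.hull ℝ S := by
  set c := truncCoeff n p k f with hc
  rcases eq_or_ne c 0 with h0 | h0
  · rw [eq_zero_of_truncCoeff_eq_zero hf h0]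
    simp
  · have hn : 0 < ‖c‖ := norm_pos_iff.2 h0
    have hmem : Ψ (ofCoeff n p k (‖c‖⁻¹ • c) * ofCoeff n p k (‖c‖⁻¹ • c)) ∈
        PointedCone.hull ℝ S := by
      refine PointedCone.subset_hull (hS ⟨_, ?_, rfl⟩)
      simp [norm_smul, inv_mul_cancel₀ hn.ne']
    have := PointedCone.smul_mem _ (mul_self_nonneg ‖c‖) hmem
    rwa [map_smul, smul_mul_smul_comm, map_smul, smul_smul, hc, ofCoeff_truncCoeff hf, ← hc,
      mul_mul_mul_comm, mul_inv_cancel₀ hn.ne', one_mul, one_smul] at this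

end Squares

section Certificate

variable {J : Type*} [Fintype J]

/-- Membership in the quadratic module of `g`, truncated at degree `2 * d`. -/
def IsCertificate (g : J → Poly n p) (d : ℕ) (r : Poly n p) : Prop :=
  ∃ (σ₀ : Poly n p) (σ : J → Poly n p), IsSumSq σ₀ ∧ σ₀.totalDegree ≤ 2 * d ∧
    (∀ j, IsSumSq (σ j) ∧ (σ j = 0 ∨ (σ j).totalDegree + 2 * halfDeg (g j) ≤ 2 * d)) ∧
    r = σ₀ + ∑ j, σ j * g j

variable {g : J → Poly n p} {d : ℕ} {r s : Poly n p}

lemma totalDegree_le_two_mul_halfDeg (f : Poly n p) : f.totalDegree ≤ 2 * halfDeg f := by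
  unfold halfDeg; omega

lemma IsCertificate.totalDegree_le (hr : IsCertificate g d r) : r.totalDegree ≤ 2 * d := by
  obtain ⟨σ₀, σ, -, h0, h, rfl⟩ := hr
  refine (totalDegree_add _ _).trans (max_le h0 (totalDegree_finsetSum_le fun j _ ↦ ?_))
  rcases (h j).2 with hj | hj
  · simp [hj]
  · exact (totalDegree_mul _ _).trans
      ((add_le_add_right (totalDegree_le_two_mul_halfDeg _) _).trans hj)

lemma IsCertificate.add (hr : IsCertificate g d r) (hs : IsCertificate g d s) :
    IsCertificate g d (r + s) := by
  obtain ⟨σ₀, σ, h1, h2, h3, rfl⟩ := hr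
  obtain ⟨τ₀, τ, k1, k2, k3, rfl⟩ := hs
  refine ⟨σ₀ + τ₀, σ + τ, h1.add k1, (totalDegree_add _ _).trans (max_le h2 k2), fun j ↦
    ⟨(h3 j).1.add (k3 j).1, ?_⟩, ?_⟩
  · rcases (h3 j).2 with hj | hj
    · simpa [hj] using (k3 j).2
    · rcases (k3 j).2 with kj | kj
      · right
        simpa [kj] using hj
      · right
        have := totalDegree_add (σ j) (τ j)
        rw [Pi.add_apply]
        rcases le_max_iff.1 this with h | h <;> omega
  · simp only [Pi.add_apply, add_mul, Finset.sum_add_distrib]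
    ring

lemma IsCertificate.smul (hr : IsCertificate g d r) {c : ℝ} (hc : 0 ≤ c) :
    IsCertificate g d (c • r) := by
  obtain ⟨σ₀, σ, h1, h2, h3, rfl⟩ := hr
  refine ⟨c • σ₀, c • σ, isSumSq_smul h1 hc, (totalDegree_smul_le _ _).trans h2, fun j ↦
    ⟨isSumSq_smul (h3 j).1 hc, ?_⟩, ?_⟩
  · rcases (h3 j).2 with hj | hj
    · left; simp [hj]
    · right
      have := totalDegree_smul_le c (σ j)
      rw [Pi.smul_apply]
      omega
  · simp [smul_add, Finset.smul_sum]

lemma isCertificate_zero : IsCertificate g d 0 :=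
  ⟨0, 0, .zero, by simp, fun _ ↦ ⟨.zero, .inl rfl⟩, by simp⟩

lemma isCertificate_of_isSumSq (hs : IsSumSq s) (hd : s.totalDegree ≤ 2 * d) :
    IsCertificate g d s :=
  ⟨s, 0, hs, hd, fun _ ↦ ⟨.zero, .inl rfl⟩, by simp⟩

lemma isCertificate_mul (j : J) (hs : IsSumSq s)
    (hd : s.totalDegree + 2 * halfDeg (g j) ≤ 2 * d) : IsCertificate g d (s * g j) := by
  classical
  refine ⟨0, Pi.single j s, .zero, by simp, fun i ↦ ?_, ?_⟩
  · rcases eq_or_ne i j with rfl | hij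
    · simp [hs, hd]
    · simp [hij, IsSumSq.zero]
  · rw [Finset.sum_eq_single j] <;> simp +contextual

/-- Induction principle for the truncated quadratic module. -/
lemma IsCertificate.induction {P : Poly n p → Prop} (zero : P 0)
    (add : ∀ a b, P a → P b → P (a + b)) (sq : ∀ f, f.totalDegree ≤ d → P (f * f))
    (mul : ∀ j f, halfDeg (g j) ≤ d → f.totalDegree ≤ d - halfDeg (g j) → P (g j * f * f))
    (hr : IsCertificate g d r) : P r := by
  obtain ⟨σ₀, σ, h1, h2, h3, rfl⟩ := hr
  refine add _ _ (isSumSq_induction zero add sq h1 h2) ?_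
  refine Finset.sum_induction _ P add zero fun j _ ↦ ?_
  rcases (h3 j).2 with hj | hj
  · simpa [hj] using zero
  · refine isSumSq_induction (k := d - halfDeg (g j)) (P := fun a ↦ P (a * g j)) (by simpa using zero)
      (fun a b ha hb ↦ by rw [add_mul]; exact add _ _ ha hb) (fun a ha ↦ ?_) (h3 j).1 (by omega)
    have := mul j a (by omega) ha
    rwa [mul_assoc, mul_comm] at this

end Certificate

end ChanceConstraint

/-! ### Strong duality through a closed cone. -/

namespace ChanceConstraint

open MvPolynomial

section Duality

variable {n p : ℕ} {J : Type*} [Fintype J] {g : J → Poly n p} {d : ℕ}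

lemma sosFeasible_iff {q : Poly n p} :
    SosFeasible g d q ↔ q.totalDegree ≤ 2 * d ∧ IsSumSq q ∧ IsCertificate g d (q - 1) :=
  ⟨fun h ↦ ⟨h.1, h.2, h.3⟩, fun h ↦ ⟨h.1, h.2.1, h.2.2⟩⟩

lemma isSumSq_one {R : Type*} [Semiring R] : IsSumSq (1 : R) := by
  rw [← mul_one 1]
  exact .mul_self 1

lemma sosFeasible_one : SosFeasible g d 1 :=
  ⟨by simp, isSumSq_one, by rw [sub_self]; exact isCertificate_zero⟩

omit [Fintype J] in
-- Replaces matrices by inequalities for functionals. The guard `halfDeg (g j) ≤ d` makes the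
-- natural subtraction agree with the integer one; otherwise the localizing matrix is empty.
lemma momentFeasible_iff {X : Set (Fin n → ℝ)} {μ : Measure (Fin p → ℝ)} {y z : Index n p → ℝ} :
    MomentFeasible X μ g d y z ↔
      (∀ γ : Index n p, γ.degree ≤ 2 * d → y γ + z γ = momentProd X μ γ) ∧
      (∀ f : Poly n p, f.totalDegree ≤ d → 0 ≤ rieszLin y (f * f)) ∧
      (∀ f : Poly n p, f.totalDegree ≤ d → 0 ≤ rieszLin z (f * f)) ∧
      (∀ j (f : Poly n p), halfDeg (g j) ≤ d → f.totalDegree ≤ d - halfDeg (g j) →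
        0 ≤ rieszLin y (g j * f * f)) := by
  have h1 : ∀ w : Index n p → ℝ, (momentMatrix d w).PosSemidef ↔
      ∀ f : Poly n p, f.totalDegree ≤ d → 0 ≤ rieszLin w (f * f) := by
    intro w
    rw [momentMatrix_eq, posSemidef_localizing_iff]
    refine forall_congr' fun f ↦ ?_
    rw [one_mul]
    exact ⟨fun h hf ↦ h (.inr (by exact_mod_cast hf)), fun h hf ↦ h <| by
      rcases hf with rfl | hf
      · simp
      · exact_mod_cast hf⟩
  have h2 : (∀ j, (localizingMatrix ((d : ℤ) - halfDeg (g j)) (g j) y).PosSemidef) ↔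
      ∀ j (f : Poly n p), halfDeg (g j) ≤ d → f.totalDegree ≤ d - halfDeg (g j) →
        0 ≤ rieszLin y (g j * f * f) := by
    refine forall_congr' fun j ↦ ?_
    rw [posSemidef_localizing_iff]
    refine forall_congr' fun f ↦ ⟨fun h hd hf ↦ h (.inr (by omega)), fun h hf ↦ ?_⟩
    rcases hf with rfl | hf
    · simp
    · exact h (by omega) (by omega)
  rw [← h1, ← h1, ← h2]
  exact ⟨fun h ↦ ⟨h.1, h.2, h.3, h.4⟩, fun h ↦ ⟨h.1, h.2.1, h.2.2.1, h.2.2.2⟩⟩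

lemma rieszLin_nonneg_of_isCertificate {y : Index n p → ℝ}
    (h1 : ∀ f : Poly n p, f.totalDegree ≤ d → 0 ≤ rieszLin y (f * f))
    (h2 : ∀ j (f : Poly n p), halfDeg (g j) ≤ d → f.totalDegree ≤ d - halfDeg (g j) →
        0 ≤ rieszLin y (g j * f * f)) {r : Poly n p} (hr : IsCertificate g d r) :
    0 ≤ rieszLin y r :=
  hr.induction (P := fun r ↦ 0 ≤ rieszLin y r) (by simp)
    (fun a b ha hb ↦ by rw [map_add]; exact add_nonneg ha hb) h1 h2

lemma rieszLin_nonneg_of_isSumSq {y : Index n p → ℝ}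
    (h1 : ∀ f : Poly n p, f.totalDegree ≤ d → 0 ≤ rieszLin y (f * f))
    {r : Poly n p} (hr : IsSumSq r) (hd : r.totalDegree ≤ 2 * d) : 0 ≤ rieszLin y r :=
  isSumSq_induction (P := fun r ↦ 0 ≤ rieszLin y r) (by simp)
    (fun a b ha hb ↦ by rw [map_add]; exact add_nonneg ha hb) h1 hr hd

/-- Functionals that agree on the monomials of degree at most `k` agree on polynomials of degree
at most `k`. -/
lemma rieszLin_add_eq {y z m : Index n p → ℝ} {k : ℕ}
    (h : ∀ γ : Index n p, γ.degree ≤ k → y γ + z γ = m γ) {f : Poly n p}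
    (hf : f.totalDegree ≤ k) : rieszLin y f + rieszLin z f = rieszLin m f := by
  simp only [rieszLin_eq_sum _ hf, ← Finset.sum_add_distrib, ← mul_add]
  exact Finset.sum_congr rfl fun γ _ ↦ by rw [h γ.1 γ.2]

/-- Weak duality: add `0 ≤ L_y (q - 1)` and `0 ≤ L_z q`. -/
lemma MomentFeasible.le_of_sosFeasible {X : Set (Fin n → ℝ)} {μ : Measure (Fin p → ℝ)}
    {y z : Index n p → ℝ} (h : MomentFeasible X μ g d y z) {q : Poly n p}
    (hq : SosFeasible g d q) : y 0 ≤ rieszLin (momentProd X μ) q := by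
  obtain ⟨hsum, hy, hz, hl⟩ := momentFeasible_iff.1 h
  obtain ⟨hd, hs, hc⟩ := sosFeasible_iff.1 hq
  have h1 := rieszLin_nonneg_of_isCertificate hy hl hc
  have h2 := rieszLin_nonneg_of_isSumSq hz hs hd
  have h3 := rieszLin_add_eq hsum hd
  rw [map_sub, rieszLin_one] at h1
  linarith

/-- The space in which the cone of the semidefinite program of order `d` lives. -/
abbrev ConeSpace (n p d : ℕ) : Type := ({γ : Index n p // γ.degree ≤ 2 * d} → ℝ) × ℝ

/-- The embedding `q ↦ (q, L q)`. -/
noncomputable def graphMap (d : ℕ) (m : Index n p → ℝ) : Poly n p →ₗ[ℝ] ConeSpace n p d :=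
  (truncCoeff n p (2 * d)).prod (rieszLin m)

/-- The map `f ↦ (- g f, 0)`. -/
noncomputable def negMulMap (d : ℕ) (g : Poly n p) : Poly n p →ₗ[ℝ] ConeSpace n p d :=
  (-((truncCoeff n p (2 * d)).comp (LinearMap.mulLeft ℝ g))).prod 0

lemma graphMap_apply (m : Index n p → ℝ) (f : Poly n p) :
    graphMap d m f = (truncCoeff n p (2 * d) f, rieszLin m f) := rfl

lemma negMulMap_apply (g f : Poly n p) :
    negMulMap d g f = (-truncCoeff n p (2 * d) (g * f), 0) := rfl

/-- The generators of the cone of the semidefinite program of order `d`. -/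
def coneGenerators (g : J → Poly n p) (d : ℕ) (m : Index n p → ℝ) : Set (ConeSpace n p d) :=
  squareImage (graphMap d m) d ∪ squareImage (negMulMap d 1) d ∪
    -- A zero constraint would contribute the generator `0`, on which no linear functional is
    -- positive.
    (⋃ j ∈ {j | g j ≠ 0 ∧ halfDeg (g j) ≤ d},
      squareImage (negMulMap d (g j)) (d - halfDeg (g j))) ∪ {(0, 1)}

lemma isCompact_coneGenerators (m : Index n p → ℝ) : IsCompact (coneGenerators g d m) :=
  (((isCompact_squareImage _ _).union (isCompact_squareImage _ _)).union
    ((Set.toFinite _).isCompact_biUnion fun _ _ ↦ isCompact_squareImage _ _)).union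
    isCompact_singleton

/-- The cone of the semidefinite program of order `d`. -/
def programCone (g : J → Poly n p) (d : ℕ) (m : Index n p → ℝ) :
    PointedCone ℝ (ConeSpace n p d) :=
  PointedCone.hull ℝ (coneGenerators g d m)

omit [Fintype J] in
lemma zero_one_mem_programCone (m : Index n p → ℝ) : (0, 1) ∈ programCone g d m :=
  PointedCone.subset_hull (.inr rfl)

omit [Fintype J] in
lemma graphMap_mem_programCone (m : Index n p → ℝ) {s : Poly n p} (hs : IsSumSq s)
    (hd : s.totalDegree ≤ 2 * d) : graphMap d m s ∈ programCone g d m := by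
  refine isSumSq_induction (P := fun s ↦ graphMap d m s ∈ programCone g d m) (by simp)
    (fun a b ha hb ↦ by rw [map_add]; exact add_mem ha hb) (fun f hf ↦ ?_) hs hd
  exact map_mul_self_mem_hull (fun x hx ↦ .inl (.inl (.inl hx))) hf

lemma neg_mem_programCone (m : Index n p → ℝ) {r : Poly n p} (hr : IsCertificate g d r) :
    (-truncCoeff n p (2 * d) r, (0 : ℝ)) ∈ programCone g d m := by
  refine hr.induction (P := fun r ↦ (-truncCoeff n p (2 * d) r, (0 : ℝ)) ∈ programCone g d m)
    ?_ (fun a b ha hb ↦ ?_) (fun f hf ↦ ?_) fun j f hj hf ↦ ?_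
  · rw [map_zero, neg_zero]; exact zero_mem _
  · convert add_mem ha hb using 1
    simp [add_comm]
  · have : negMulMap d 1 (f * f) ∈ programCone g d m :=
      map_mul_self_mem_hull (fun x hx ↦ .inl (.inl (.inr hx))) hf
    rwa [negMulMap_apply, one_mul] at this
  · by_cases h0 : g j = 0
    · rw [h0, zero_mul, zero_mul, map_zero, neg_zero]; exact zero_mem _
    · have : negMulMap d (g j) (f * f) ∈ programCone g d m :=
        map_mul_self_mem_hull
          (fun x hx ↦ .inl (.inr (Set.mem_biUnion (show j ∈ {j | _} from ⟨h0, hj⟩) hx))) hf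
      rwa [negMulMap_apply, ← mul_assoc] at this

lemma exists_of_mem_programCone {m : Index n p → ℝ} {x : ConeSpace n p d}
    (hx : x ∈ programCone g d m) :
    ∃ (q r : Poly n p) (t : ℝ), IsSumSq q ∧ q.totalDegree ≤ 2 * d ∧ IsCertificate g d r ∧ 0 ≤ t ∧
      x = (truncCoeff n p (2 * d) q - truncCoeff n p (2 * d) r, rieszLin m q + t) := by
  induction hx using Submodule.span_induction with
  | mem x hx =>
    rcases hx with ((hx | hx) | hx) | hx
    · obtain ⟨f, -, hf, rfl⟩ := exists_of_mem_squareImage hx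
      refine ⟨f * f, 0, 0, .mul_self f, (totalDegree_mul _ _).trans (by omega), isCertificate_zero,
        le_rfl, ?_⟩
      simp [graphMap_apply]
    · obtain ⟨f, -, hf, rfl⟩ := exists_of_mem_squareImage hx
      refine ⟨0, f * f, 0, .zero, by simp, isCertificate_of_isSumSq (.mul_self f)
        ((totalDegree_mul _ _).trans (by omega)), le_rfl, ?_⟩
      simp [negMulMap_apply]
    · obtain ⟨j, ⟨-, hj⟩, hx⟩ := Set.mem_iUnion₂.1 hx
      obtain ⟨f, -, hf, rfl⟩ := exists_of_mem_squareImage hx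
      refine ⟨0, f * f * g j, 0, .zero, by simp, isCertificate_mul j (.mul_self f)
        ((add_le_add_left (totalDegree_mul _ _) _).trans (by omega)), le_rfl, ?_⟩
      simp [negMulMap_apply, mul_comm]
    · rw [hx]
      exact ⟨0, 0, 1, .zero, by simp, isCertificate_zero, zero_le_one, by simp⟩
  | zero => exact ⟨0, 0, 0, .zero, by simp, isCertificate_zero, le_rfl, by simp; rfl⟩
  | add x y _ _ ihx ihy =>
    obtain ⟨q, r, t, h1, h2, h3, h4, rfl⟩ := ihx
    obtain ⟨q', r', t', h1', h2', h3', h4', rfl⟩ := ihy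
    refine ⟨q + q', r + r', t + t', h1.add h1', (totalDegree_add _ _).trans (max_le h2 h2'),
      h3.add h3', add_nonneg h4 h4', ?_⟩
    simp only [map_add, Prod.mk_add_mk, Prod.mk.injEq]
    constructor
    · abel
    · ring
  | smul c x _ ih =>
    obtain ⟨q, r, t, h1, h2, h3, h4, rfl⟩ := ih
    refine ⟨(c : ℝ) • q, (c : ℝ) • r, (c : ℝ) * t, isSumSq_smul h1 c.2,
      (totalDegree_smul_le _ _).trans h2, h3.smul c.2, mul_nonneg c.2 h4, ?_⟩
    rw [map_smul, map_smul, map_smul, ← smul_sub, smul_eq_mul, ← mul_add]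
    rfl

/-- An element `(q - s, L_m q + t)` of the cone equal to `(1, r)` gives `q - 1 = s`, because all
degrees are at most `2 * d` and truncation loses nothing; `t` is the slack in the objective. -/
lemma mem_programCone_iff {m : Index n p → ℝ} {r : ℝ} :
    (truncCoeff n p (2 * d) 1, r) ∈ programCone g d m ↔
      ∃ q, SosFeasible g d q ∧ rieszLin m q ≤ r := by
  constructor
  · intro h
    obtain ⟨q, s, t, h1, h2, h3, h4, h5⟩ := exists_of_mem_programCone h
    rw [Prod.mk.injEq] at h5
    have hz : 1 - (q - s) = 0 := by
      refine eq_zero_of_truncCoeff_eq_zero (k := 2 * d) ?_ (by simp [map_sub, h5.1])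
      refine (totalDegree_sub _ _).trans (max_le (by simp) ?_)
      exact (totalDegree_sub _ _).trans (max_le h2 h3.totalDegree_le)
    refine ⟨q, sosFeasible_iff.2 ⟨h2, h1, ?_⟩, by linarith⟩
    have : q - 1 = s := by linear_combination -hz
    rwa [this]
  · rintro ⟨q, hq, hr⟩
    obtain ⟨hd, hs, hc⟩ := sosFeasible_iff.1 hq
    have h1 := graphMap_mem_programCone (g := g) m hs hd
    have h2 := neg_mem_programCone m hc
    have h3 := PointedCone.smul_mem _ (sub_nonneg.2 hr) (zero_one_mem_programCone (g := g) (d := d) m)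
    convert add_mem (add_mem h1 h2) h3 using 1
    simp [graphMap_apply]

/-- A Slater-type condition, expressed by a strictly positive functional `mK` which is strictly
dominated by `m`. -/
structure StrictlyFeasible (g : J → Poly n p) (m mK : Index n p → ℝ) : Prop where
  pos : ∀ f : Poly n p, f ≠ 0 → 0 < rieszLin mK (f * f)
  pos_mul : ∀ j (f : Poly n p), g j ≠ 0 → f ≠ 0 → 0 < rieszLin mK (g j * f * f)
  lt : ∀ f : Poly n p, f ≠ 0 → rieszLin mK (f * f) < rieszLin m (f * f)

variable {m mK : Index n p → ℝ}

/-- The functional `(f, t) ↦ t - L_mK f` is positive on every generator: its values are `L_m (f²) -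
L_mK (f²)`, `L_mK (f²)`, `L_mK (g_j f²)` and `1`. -/
lemma StrictlyFeasible.isClosed (h : StrictlyFeasible g m mK) :
    IsClosed (programCone g d m : Set (ConeSpace n p d)) := by
  let l : ConeSpace n p d →ₗ[ℝ] ℝ :=
    LinearMap.snd ℝ _ ℝ - (∑ γ, mK γ.1 • LinearMap.proj γ).comp (LinearMap.fst ℝ _ ℝ)
  have hl : ∀ (f : Poly n p) (t : ℝ), f.totalDegree ≤ 2 * d →
      l (truncCoeff n p (2 * d) f, t) = t - rieszLin mK f := by
    intro f t hf
    simp [l, rieszLin_eq_sum mK hf, mul_comm]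
  have hl' : ∀ (f : Poly n p), f.totalDegree ≤ 2 * d →
      l (-truncCoeff n p (2 * d) f, 0) = rieszLin mK f := by
    intro f hf
    rw [← map_neg, hl _ _ (by rwa [totalDegree_neg]), map_neg]
    ring
  refine (isCompact_coneGenerators m).isClosed_hull ⟨_, .inr rfl⟩ l fun x hx ↦ ?_
  rcases hx with ((hx | hx) | hx) | hx
  · obtain ⟨f, h0, hf, rfl⟩ := exists_of_mem_squareImage hx
    rw [graphMap_apply, hl _ _ ((totalDegree_mul _ _).trans (by omega))]
    exact sub_pos.2 (h.lt f h0)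
  · obtain ⟨f, h0, hf, rfl⟩ := exists_of_mem_squareImage hx
    rw [negMulMap_apply, one_mul, hl' _ ((totalDegree_mul _ _).trans (by omega))]
    exact h.pos f h0
  · obtain ⟨j, ⟨hj0, hj⟩, hx⟩ := Set.mem_iUnion₂.1 hx
    obtain ⟨f, h0, hf, rfl⟩ := exists_of_mem_squareImage hx
    have h1 := totalDegree_le_two_mul_halfDeg (g j)
    have h2 := totalDegree_mul f f
    rw [negMulMap_apply, ← mul_assoc, hl' _ (by
      refine (totalDegree_mul _ _).trans ?_
      have := totalDegree_mul (g j) f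
      omega)]
    exact h.pos_mul j f hj0 h0
  · rw [hx]
    simp [l]

omit [Fintype J] in
lemma StrictlyFeasible.nonneg (h : StrictlyFeasible g m mK) {q : Poly n p}
    (hq : IsSumSq q) (hd : q.totalDegree ≤ 2 * d) : 0 ≤ rieszLin m q := by
  refine rieszLin_nonneg_of_isSumSq (fun f _ ↦ ?_) hq hd
  rcases eq_or_ne f 0 with rfl | h0
  · simp
  · exact ((h.pos f h0).trans (h.lt f h0)).le

/-- The objective values, enlarged by slack, form a slice of the closed cone. It is nonempty because
`q = 1` is feasible and bounded below by `0`, so its infimum is attained. -/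
lemma StrictlyFeasible.exists_isMin (h : StrictlyFeasible g m mK) (d : ℕ) :
    ∃ q, SosFeasible g d q ∧ ∀ q', SosFeasible g d q' → rieszLin m q ≤ rieszLin m q' := by
  set A : Set ℝ := {r | (truncCoeff n p (2 * d) 1, r) ∈ programCone g d m} with hA
  have hmem : ∀ q, SosFeasible g d q → rieszLin m q ∈ A := fun q hq ↦
    mem_programCone_iff.2 ⟨q, hq, le_rfl⟩
  have hclosed : IsClosed A := h.isClosed.preimage (by fun_prop : Continuous fun r : ℝ ↦
    ((truncCoeff n p (2 * d) 1, r) : ConeSpace n p d))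
  have hbdd : BddBelow A := by
    refine ⟨0, fun r hr ↦ ?_⟩
    obtain ⟨q, hq, hqr⟩ := mem_programCone_iff.1 hr
    exact (h.nonneg hq.isSumSq hq.degree_le).trans hqr
  obtain ⟨q, hq, hle⟩ := mem_programCone_iff.1
    (hclosed.csInf_mem ⟨_, hmem 1 sosFeasible_one⟩ hbdd)
  exact ⟨q, hq, fun q' hq' ↦ hle.trans (csInf_le hbdd (hmem q' hq'))⟩

lemma StrictlyFeasible.exists_momentFeasible {X : Set (Fin n → ℝ)} {μ : Measure (Fin p → ℝ)}
    (h : StrictlyFeasible g (momentProd X μ) mK) {r : ℝ}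
    (hr : ∀ q, SosFeasible g d q → r < rieszLin (momentProd X μ) q) :
    ∃ y z, MomentFeasible X μ g d y z ∧ r < y 0 := by
  set m := momentProd X μ
  let C : ProperCone ℝ (ConeSpace n p d) := ⟨programCone g d m, h.isClosed⟩
  have hnot : (truncCoeff n p (2 * d) 1, r) ∉ C := by
    intro hC
    obtain ⟨q, hq, hle⟩ := mem_programCone_iff.1 (show _ ∈ programCone g d m from hC)
    exact absurd (hr q hq) (not_lt.2 hle)
  obtain ⟨φ, hφ, hneg⟩ := C.hyperplane_separation_point hnot
  replace hφ : ∀ x ∈ programCone g d m, 0 ≤ φ x := hφ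
  have hsplit : ∀ (v : {γ : Index n p // γ.degree ≤ 2 * d} → ℝ) (t : ℝ),
      φ (v, t) = φ (v, 0) + t * φ (0, 1) := by
    intro v t
    have : ((v, t) : ConeSpace n p d) = (v, 0) + t • (0, 1) := by simp
    rw [this, map_add, map_smul, smul_eq_mul]
  set b := φ (0, 1) with hb
  have hb0 : 0 ≤ b := hφ _ (zero_one_mem_programCone m)
  -- The separating hyperplane is not vertical: for `b = 0`, the element of the cone given by `q =
  -- 1` would force `φ (1, 0) ≥ 0`, against the separation.
  have hbpos : 0 < b := by
    refine lt_of_le_of_ne hb0 fun hb' ↦ ?_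
    have h1 := hφ _ (graphMap_mem_programCone (g := g) (d := d) m isSumSq_one (by simp))
    rw [graphMap_apply, hsplit, ← hb', mul_zero, add_zero] at h1
    rw [hsplit, ← hb', mul_zero, add_zero] at hneg
    exact absurd h1 (not_le.2 hneg)
  -- Dividing by `b` normalizes `φ` to `(f, t) ↦ t - L_y f`. Positivity on `(-r, 0)` gives the
  -- constraints on `y`, positivity on `(q, L_m q)` gives those on `z = m - y`, and negativity at
  -- `(1, r)` reads `r < y 0`.
  let y : Index n p → ℝ := fun γ ↦ -(φ (truncCoeff n p (2 * d) (monomial γ 1), 0) / b)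
  have hy : ∀ f, rieszLin y f = -(φ (truncCoeff n p (2 * d) f, 0) / b) := by
    let A : Poly n p →ₗ[ℝ] ℝ := -(b⁻¹ • ((φ : ConeSpace n p d →ₗ[ℝ] ℝ).comp
      ((truncCoeff n p (2 * d)).prod 0)))
    have hA : rieszLin y = A := by
      refine (basisMonomials _ ℝ).ext fun γ ↦ ?_
      rw [coe_basisMonomials, rieszLin_monomial]
      simp [A, y, div_eq_inv_mul]
    intro f
    rw [hA]
    simp [A, div_eq_inv_mul]
  have hynn : ∀ s, IsCertificate g d s → 0 ≤ rieszLin y s := by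
    intro s hs
    have h1 := hφ _ (neg_mem_programCone m hs)
    have h2 : φ (-truncCoeff n p (2 * d) s, 0) = -φ (truncCoeff n p (2 * d) s, 0) := by
      rw [← map_neg φ, Prod.neg_mk, neg_zero]
    rw [hy, ← neg_div, ← h2]
    exact div_nonneg h1 hb0
  refine ⟨y, fun γ ↦ m γ - y γ, momentFeasible_iff.2 ⟨fun γ _ ↦ by ring, fun f hf ↦ ?_,
    fun f hf ↦ ?_, fun j f hj hf ↦ ?_⟩, ?_⟩
  · exact hynn _ (isCertificate_of_isSumSq (.mul_self f) ((totalDegree_mul _ _).trans (by omega)))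
  · have hd : (f * f).totalDegree ≤ 2 * d := (totalDegree_mul _ _).trans (by omega)
    have h1 := hφ _ (graphMap_mem_programCone (g := g) m (.mul_self f) hd)
    rw [graphMap_apply, hsplit] at h1
    have h2 := rieszLin_add_eq (y := y) (z := fun γ ↦ m γ - y γ) (m := m) (fun γ _ ↦ by ring) hd
    rw [hy] at h2
    have h3 : 0 ≤ φ (truncCoeff n p (2 * d) (f * f), 0) / b + rieszLin m (f * f) := by
      have := div_nonneg h1 hb0
      rwa [add_div, mul_div_cancel_right₀ _ hbpos.ne'] at this
    linarith
  · have h1 := hynn _ (isCertificate_mul j (.mul_self f)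
      ((add_le_add_left (totalDegree_mul _ _) _).trans (by omega)))
    rwa [mul_comm, ← mul_assoc] at h1
  · rw [← rieszLin_one y, hy, ← neg_div, lt_div_iff₀ hbpos]
    rw [hsplit] at hneg
    linarith

lemma StrictlyFeasible.momentValue_eq {X : Set (Fin n → ℝ)} {μ : Measure (Fin p → ℝ)}
    (h : StrictlyFeasible g (momentProd X μ) mK) {q : Poly n p} (hq : SosFeasible g d q)
    (hmin : ∀ q', SosFeasible g d q' →
      rieszLin (momentProd X μ) q ≤ rieszLin (momentProd X μ) q') :
    momentValue X μ g d = (rieszLin (momentProd X μ) q : ℝ) := by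
  apply le_antisymm
  · refine sSup_le ?_
    rintro _ ⟨y, z, hyz, rfl⟩
    exact_mod_cast hyz.le_of_sosFeasible hq
  · refine EReal.ge_of_forall_gt_iff_ge.1 fun r hr ↦ ?_
    obtain ⟨y, z, hyz, hlt⟩ := h.exists_momentFeasible (d := d) (r := r) fun q' hq' ↦
      lt_of_lt_of_le (by exact_mod_cast hr) (hmin q' hq')
    exact le_trans (by exact_mod_cast hlt.le) (le_sSup ⟨y, z, hyz, rfl⟩)

end Duality

end ChanceConstraint

/-! ### Evaluation, the reference measure and the strict feasibility of its restriction to `K`. -/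

namespace ChanceConstraint

open MvPolynomial

variable {n p : ℕ}

lemma continuous_evalAt (f : Poly n p) :
    Continuous fun z : (Fin n → ℝ) × (Fin p → ℝ) ↦ evalAt f z.1 z.2 := by
  refine (MvPolynomial.continuous_eval f).comp ?_
  refine continuous_pi fun i ↦ ?_
  rcases i with i | i
  · exact (continuous_apply i).comp continuous_fst
  · exact (continuous_apply i).comp continuous_snd

section EvalAt

variable (f h : Poly n p) (x : Fin n → ℝ) (w : Fin p → ℝ)

@[simp] lemma evalAt_add : evalAt (f + h) x w = evalAt f x w + evalAt h x w := map_add _ _ _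
@[simp] lemma evalAt_sub : evalAt (f - h) x w = evalAt f x w - evalAt h x w := map_sub _ _ _
@[simp] lemma evalAt_mul : evalAt (f * h) x w = evalAt f x w * evalAt h x w := map_mul _ _ _
@[simp] lemma evalAt_one : evalAt (1 : Poly n p) x w = 1 := map_one _
@[simp] lemma evalAt_C (c : ℝ) : evalAt (C c : Poly n p) x w = c := eval_C _
@[simp] lemma evalAt_sum {ι : Type*} (s : Finset ι) (F : ι → Poly n p) :
    evalAt (∑ i ∈ s, F i) x w = ∑ i ∈ s, evalAt (F i) x w := map_sum _ _ _

lemma evalAt_monomial (γ : Index n p) (c : ℝ) : evalAt (monomial γ c : Poly n p) x w =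
    c * ((∏ i, x i ^ γ (Sum.inl i)) * ∏ k, w k ^ γ (Sum.inr k)) := by
  rw [evalAt, eval_monomial, Finsupp.prod_fintype _ _ (by simp), Fintype.prod_sum_type]
  simp

variable {f} in
lemma evalAt_nonneg_of_isSumSq (hf : IsSumSq f) : 0 ≤ evalAt f x w := by
  induction hf with
  | zero => exact (map_zero (eval (Sum.elim x w))).ge
  | sq_add a _ ih =>
    rw [evalAt_add, evalAt_mul]
    exact add_nonneg (mul_self_nonneg _) ih

end EvalAt

/-- A nonzero polynomial does not vanish identically on a nonempty open set. -/
lemma exists_evalAt_ne_zero {f : Poly n p} (hf : f ≠ 0) {U : Set ((Fin n → ℝ) × (Fin p → ℝ))}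
    (hU : IsOpen U) (hne : U.Nonempty) : ∃ z ∈ U, evalAt f z.1 z.2 ≠ 0 := by
  by_contra! hcon
  obtain ⟨z, hz⟩ := hne
  let e : ((Fin n ⊕ Fin p) → ℝ) ≃ₜ (Fin n → ℝ) × (Fin p → ℝ) :=
    Homeomorph.sumArrowHomeomorphProdArrow
  obtain ⟨r, hr, hball⟩ := Metric.isOpen_iff.1 (hU.preimage e.continuous) (Sum.elim z.1 z.2)
    (by simpa [e, Homeomorph.sumArrowHomeomorphProdArrow, Equiv.sumArrowEquivProdArrow] using hz)
  -- A ball in the sup norm is a box with infinite sides, and a polynomial vanishing on such a box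
  -- is zero.
  refine hf (funext_set (fun i ↦ Metric.ball (Sum.elim z.1 z.2 i) r) (fun i ↦ ?_) fun v hv ↦ ?_)
  · rw [Real.ball_eq_Ioo]
    exact Set.Ioo_infinite (by linarith)
  · rw [← ball_pi _ hr] at hv
    have h1 := hcon _ (hball hv)
    have h2 : Sum.elim (e v).1 (e v).2 = v := by
      ext i
      rcases i with i | i <;> rfl
    rwa [evalAt, h2] at h1

lemma rieszLin_integral {ν : Measure ((Fin n → ℝ) × (Fin p → ℝ))}
    (hν : ∀ f : Poly n p, Integrable (fun z ↦ evalAt f z.1 z.2) ν) (f : Poly n p) :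
    rieszLin (fun γ ↦ ∫ z, evalAt (monomial γ 1 : Poly n p) z.1 z.2 ∂ν) f =
      ∫ z, evalAt f z.1 z.2 ∂ν := by
  conv_rhs => rw [← support_sum_monomial_coeff f]
  simp only [evalAt_sum]
  rw [integral_finsetSum _ fun γ _ ↦ hν _, ← riesz_eq, riesz]
  refine Finset.sum_congr rfl fun γ _ ↦ ?_
  rw [← integral_const_mul]
  simp [evalAt_monomial]

section Measure

variable {X : Set (Fin n → ℝ)} {Om : Set (Fin p → ℝ)} {μ : Measure (Fin p → ℝ)}
  [IsProbabilityMeasure μ]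

lemma isFiniteMeasure_refMeasure (hX : IsCompact X) : IsFiniteMeasure (refMeasure X μ) := by
  have : IsFiniteMeasure ((volume : Measure (Fin n → ℝ)).restrict X) :=
    ⟨by rw [Measure.restrict_apply_univ]; exact hX.measure_lt_top⟩
  unfold refMeasure
  infer_instance

omit [IsProbabilityMeasure μ] in
lemma ae_mem_of_support_eq (hμ : μ.support = Om) : ∀ᵐ w ∂μ, w ∈ Om := by
  rw [← hμ]
  exact Measure.support_mem_ae

omit [IsProbabilityMeasure μ] in
lemma ae_mem_prod (hX : IsCompact X) (hμ : μ.support = Om) :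
    ∀ᵐ z ∂(refMeasure X μ), z ∈ X ×ˢ Om := by
  have h1 : ∀ᵐ z ∂(refMeasure X μ), z.1 ∈ X :=
    Measure.quasiMeasurePreserving_fst.ae (ae_restrict_mem hX.measurableSet)
  have h2 : ∀ᵐ z ∂(refMeasure X μ), z.2 ∈ Om :=
    Measure.quasiMeasurePreserving_snd.ae (ae_mem_of_support_eq hμ)
  filter_upwards [h1, h2] with z hz1 hz2 using ⟨hz1, hz2⟩

lemma integrable_refMeasure (hX : IsCompact X) (hOm : IsCompact Om) (hμ : μ.support = Om)
    {f : (Fin n → ℝ) × (Fin p → ℝ) → ℝ} (hf : Continuous f) :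
    Integrable f (refMeasure X μ) := by
  have := isFiniteMeasure_refMeasure (μ := μ) hX
  have h := hf.continuousOn.integrableOn_compact (μ := refMeasure X μ) (hX.prod hOm)
  rwa [IntegrableOn, Measure.restrict_eq_self_of_ae_mem (ae_mem_prod hX hμ)] at h

lemma integrable_of_support (hOm : IsCompact Om) (hμ : μ.support = Om)
    {f : (Fin p → ℝ) → ℝ} (hf : Continuous f) : Integrable f μ := by
  have h := hf.continuousOn.integrableOn_compact (μ := μ) hOm
  rwa [IntegrableOn, Measure.restrict_eq_self_of_ae_mem (ae_mem_of_support_eq hμ)] at h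

lemma rieszLin_momentProd (hX : IsCompact X) (hOm : IsCompact Om) (hμ : μ.support = Om)
    (f : Poly n p) :
    rieszLin (momentProd X μ) f = ∫ z, evalAt f z.1 z.2 ∂(refMeasure X μ) := by
  rw [← rieszLin_integral fun f ↦ integrable_refMeasure hX hOm hμ (continuous_evalAt f)]
  congr 2
  ext γ
  simp only [evalAt_monomial, one_mul]
  exact (integral_prod_mul (μ := volume.restrict X) (ν := μ)
    (fun x : Fin n → ℝ ↦ ∏ i, x i ^ γ (Sum.inl i))
    (fun w : Fin p → ℝ ↦ ∏ k, w k ^ γ (Sum.inr k))).symm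

/-- `U` contains an open rectangle `A ×ˢ B`. Here `A` lies in `X` and has positive Lebesgue measure,
and `B` is a neighbourhood of a point of the support of `μ`. -/
lemma refMeasure_pos_of_isOpen (hμ : μ.support = Om) {U : Set ((Fin n → ℝ) × (Fin p → ℝ))}
    (hU : IsOpen U) (hne : U.Nonempty) (hsub : U ⊆ X ×ˢ Om) : 0 < refMeasure X μ U := by
  obtain ⟨z, hz⟩ := hne
  obtain ⟨A, B, hA, hB, hzA, hzB, hAB⟩ := isOpen_prod_iff.1 hU z.1 z.2 hz
  refine lt_of_lt_of_le ?_ (measure_mono hAB)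
  have hAX : A ⊆ X := fun x hx ↦ (hsub (hAB (Set.mk_mem_prod hx hzB))).1
  rw [refMeasure, Measure.prod_prod, Measure.restrict_apply hA.measurableSet,
    Set.inter_eq_left.2 hAX]
  refine ENNReal.mul_pos (hA.measure_pos _ ⟨_, hzA⟩).ne' ?_
  have : z.2 ∈ μ.support := hμ ▸ (hsub hz).2
  exact ((Measure.mem_support_iff_forall _).1 this B (hB.mem_nhds hzB)).ne'

lemma setIntegral_evalAt_pos (hX : IsCompact X) (hOm : IsCompact Om) (hμ : μ.support = Om)
    {A U : Set ((Fin n → ℝ) × (Fin p → ℝ))} (hA : MeasurableSet A) (hU : IsOpen U)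
    (hne : U.Nonempty) (hUA : U ⊆ A) (hUB : U ⊆ X ×ˢ Om) {f : Poly n p} (hf : f ≠ 0)
    (hnn : ∀ z ∈ A, 0 ≤ evalAt f z.1 z.2) :
    0 < ∫ z in A, evalAt f z.1 z.2 ∂(refMeasure X μ) := by
  rw [setIntegral_pos_iff_support_of_nonneg_ae (ae_restrict_of_forall_mem hA hnn)
    (integrable_refMeasure hX hOm hμ (continuous_evalAt f)).integrableOn]
  obtain ⟨z, hz, hz0⟩ := exists_evalAt_ne_zero hf hU hne
  have hopen : IsOpen (U ∩ {z | evalAt f z.1 z.2 ≠ 0}) :=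
    hU.inter ((isOpen_ne (x := (0 : ℝ))).preimage (continuous_evalAt f))
  refine (refMeasure_pos_of_isOpen hμ hopen ⟨z, hz, hz0⟩
    (Set.inter_subset_left.trans hUB)).trans_le (measure_mono ?_)
  exact fun z hz ↦ ⟨hz.2, hUA hz.1⟩

lemma isClosed_feasibleSet {J : Type*} (hX : IsCompact X) (hOm : IsCompact Om)
    (g : J → Poly n p) : IsClosed (feasibleSet X Om g) := by
  have : feasibleSet X Om g = (X ×ˢ Om) ∩ ⋂ j, {z | 0 ≤ evalAt (g j) z.1 z.2} := by
    ext z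
    simp [feasibleSet, and_assoc]
  rw [this]
  exact (hX.isClosed.prod hOm.isClosed).inter
    (isClosed_iInter fun j ↦ isClosed_le continuous_const (continuous_evalAt _))

/-- The moments of the restriction of the reference measure to a set. -/
noncomputable def momentsOn (X : Set (Fin n → ℝ)) (μ : Measure (Fin p → ℝ))
    (A : Set ((Fin n → ℝ) × (Fin p → ℝ))) (γ : Index n p) : ℝ :=
  ∫ z in A, evalAt (monomial γ 1 : Poly n p) z.1 z.2 ∂(refMeasure X μ)

/-- An interior point of `K` makes the integrals over `K` strictly positive; an interior point of
the complement in `X ×ˢ Om` makes the remaining mass of `f²` strictly positive. -/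
lemma strictlyFeasible_momentsOn {J : Type*} (hX : IsCompact X) (hOm : IsCompact Om)
    (hμ : μ.support = Om) {g : J → Poly n p} (hint : (interior (feasibleSet X Om g)).Nonempty)
    (hcint : (interior ((X ×ˢ Om) \ feasibleSet X Om g)).Nonempty) :
    StrictlyFeasible g (momentProd X μ) (momentsOn X μ (feasibleSet X Om g)) := by
  set K := feasibleSet X Om g with hK
  have hKm : MeasurableSet K := (isClosed_feasibleSet hX hOm g).measurableSet
  have hInt : ∀ f : Poly n p, Integrable (fun z ↦ evalAt f z.1 z.2) (refMeasure X μ) :=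
    fun f ↦ integrable_refMeasure hX hOm hμ (continuous_evalAt f)
  have hmom : ∀ f, rieszLin (momentsOn X μ K) f =
      ∫ z in K, evalAt f z.1 z.2 ∂(refMeasure X μ) :=
    rieszLin_integral fun f ↦ (hInt f).integrableOn
  have hKB : interior K ⊆ X ×ˢ Om := fun z hz ↦
    ⟨(interior_subset hz).1, (interior_subset hz).2.1⟩
  have hsq : ∀ (f : Poly n p) (z : (Fin n → ℝ) × (Fin p → ℝ)), 0 ≤ evalAt (f * f) z.1 z.2 :=
    fun f z ↦ evalAt_nonneg_of_isSumSq _ _ (.mul_self f)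
  refine ⟨fun f hf ↦ ?_, fun j f hj hf ↦ ?_, fun f hf ↦ ?_⟩
  · rw [hmom]
    exact setIntegral_evalAt_pos hX hOm hμ hKm isOpen_interior hint interior_subset hKB
      (mul_ne_zero hf hf) fun z _ ↦ hsq f z
  · rw [hmom]
    refine setIntegral_evalAt_pos hX hOm hμ hKm isOpen_interior hint interior_subset hKB
      (mul_ne_zero (mul_ne_zero hj hf) hf) fun z hz ↦ ?_
    rw [mul_assoc, evalAt_mul]
    exact mul_nonneg (hz.2.2 j) (hsq f z)
  · rw [hmom, rieszLin_momentProd hX hOm hμ, ← integral_add_compl hKm (hInt _)]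
    refine lt_add_of_pos_right _ ?_
    exact setIntegral_evalAt_pos hX hOm hμ hKm.compl isOpen_interior hcint
      (interior_subset.trans fun z hz ↦ hz.2) (interior_subset.trans Set.sdiff_subset)
      (mul_ne_zero hf hf) fun z _ ↦ hsq f z

/-! ### Consequences of dual feasibility, and marginals in `x`. -/

section Optimal

variable {J : Type*} [Fintype J] {g : J → Poly n p} {d : ℕ} {q : Poly n p}

lemma SosFeasible.one_le (hq : SosFeasible g d q) {z : (Fin n → ℝ) × (Fin p → ℝ)}
    (hz : z ∈ feasibleSet X Om g) : 1 ≤ evalAt q z.1 z.2 := by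
  obtain ⟨σ₀, σ, h0, -, h, he⟩ := hq.cert
  have h1 : evalAt q z.1 z.2 - 1 =
      evalAt σ₀ z.1 z.2 + ∑ j, evalAt (σ j) z.1 z.2 * evalAt (g j) z.1 z.2 := by
    simpa using congrArg (fun f ↦ evalAt f z.1 z.2) he
  have h2 : 0 ≤ ∑ j, evalAt (σ j) z.1 z.2 * evalAt (g j) z.1 z.2 :=
    Finset.sum_nonneg fun j _ ↦ mul_nonneg (evalAt_nonneg_of_isSumSq _ _ (h j).1) (hz.2.2 j)
  have h3 := evalAt_nonneg_of_isSumSq z.1 z.2 h0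
  linarith

lemma integrable_evalAt_right (hOm : IsCompact Om) (hμ : μ.support = Om) (f : Poly n p)
    (x : Fin n → ℝ) : Integrable (fun w ↦ evalAt f x w) μ :=
  integrable_of_support hOm hμ (Continuous.comp
    (g := fun z : (Fin n → ℝ) × (Fin p → ℝ) ↦ evalAt f z.1 z.2) (f := fun w ↦ (x, w))
    (continuous_evalAt f) (Continuous.prodMk_right x))

/-- Integrating out the variables `ω` yields a polynomial in `x`. -/
lemma exists_marginal (hOm : IsCompact Om) (hμ : μ.support = Om) (f : Poly n p) :
    ∃ h : MvPolynomial (Fin n) ℝ, h.totalDegree ≤ f.totalDegree ∧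
      ∀ x, eval x h = ∫ w, evalAt f x w ∂μ := by
  refine ⟨∑ γ ∈ f.support, monomial (γ.comapDomain Sum.inl Sum.inl_injective.injOn)
    (f.coeff γ * ∫ w, ∏ k, w k ^ γ (Sum.inr k) ∂μ), ?_, fun x ↦ ?_⟩
  · refine totalDegree_finsetSum_le fun γ hγ ↦ (totalDegree_monomial_le _ _).trans
      (le_trans ?_ (le_totalDegree hγ))
    change Finsupp.degree _ ≤ Finsupp.degree γ
    rw [Finsupp.degree_eq_sum, Finsupp.degree_eq_sum, Fintype.sum_sum_type]
    simp
  · conv_rhs => rw [← support_sum_monomial_coeff f]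
    simp only [evalAt_sum]
    rw [integral_finsetSum _ fun γ _ ↦ integrable_evalAt_right hOm hμ _ x, map_sum]
    refine Finset.sum_congr rfl fun γ _ ↦ ?_
    simp only [evalAt_monomial, ← mul_assoc]
    rw [integral_const_mul, eval_monomial, Finsupp.prod_fintype _ _ (by simp)]
    simp only [Finsupp.comapDomain_apply]
    ring

lemma SosFeasible.measureReal_fiber_le (hX : IsCompact X) (hOm : IsCompact Om)
    (hμ : μ.support = Om) (hq : SosFeasible g d q) (x : Fin n → ℝ) :
    μ.real (fiber (feasibleSet X Om g) x) ≤ ∫ w, evalAt q x w ∂μ := by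
  have hm : MeasurableSet (fiber (feasibleSet X Om g) x) :=
    ((isClosed_feasibleSet hX hOm g).preimage (Continuous.prodMk_right x)).measurableSet
  rw [← integral_indicator_one hm]
  refine integral_mono ((integrable_const (1 : ℝ)).indicator hm)
    (integrable_evalAt_right hOm hμ q x) fun w ↦ ?_
  by_cases hw : w ∈ fiber (feasibleSet X Om g) x
  · rw [Set.indicator_of_mem hw]
    exact hq.one_le (z := (x, w)) hw
  · rw [Set.indicator_of_notMem hw]
    exact evalAt_nonneg_of_isSumSq _ _ hq.isSumSq

lemma SosFeasible.refMeasure_le (hX : IsCompact X) (hOm : IsCompact Om)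
    (hμ : μ.support = Om) (hq : SosFeasible g d q) :
    (refMeasure X μ).real (feasibleSet X Om g) ≤
      ∫ z, evalAt q z.1 z.2 ∂(refMeasure X μ) := by
  have := isFiniteMeasure_refMeasure (μ := μ) hX
  have hm := (isClosed_feasibleSet hX hOm g).measurableSet
  rw [← integral_indicator_one hm]
  refine integral_mono ((integrable_const (1 : ℝ)).indicator hm)
    (integrable_refMeasure hX hOm hμ (continuous_evalAt q)) fun z ↦ ?_
  by_cases hz : z ∈ feasibleSet X Om g
  · rw [Set.indicator_of_mem hz]
    exact hq.one_le hz
  · rw [Set.indicator_of_notMem hz]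
    exact evalAt_nonneg_of_isSumSq _ _ hq.isSumSq

end Optimal

/-- The restriction of `λ ⊗ μ` to `K` is the largest admissible measure. -/
lemma lpValue_eq (hX : IsCompact X) {K : Set ((Fin n → ℝ) × (Fin p → ℝ))}
    (hK : MeasurableSet K) : lpValue X μ K = refMeasure X μ K := by
  have := isFiniteMeasure_refMeasure (μ := μ) hX
  apply le_antisymm
  · refine sSup_le ?_
    rintro _ ⟨φ, -, -, hφ, rfl⟩
    exact hφ K
  · refine le_sSup ⟨(refMeasure X μ).restrict K, inferInstance, ?_, Measure.restrict_le_self, ?_⟩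
    · rw [Measure.restrict_apply hK.compl]; simp
    · rw [Measure.restrict_apply_self]

lemma refMeasure_eq_lintegral {K : Set ((Fin n → ℝ) × (Fin p → ℝ))} (hK : MeasurableSet K) :
    refMeasure X μ K = ∫⁻ x in X, μ (fiber K x) :=
  Measure.prod_apply hK

lemma refMeasure_real_eq_integral {K : Set ((Fin n → ℝ) × (Fin p → ℝ))} (hK : MeasurableSet K) :
    (refMeasure X μ).real K = ∫ x in X, μ.real (fiber K x) := by
  rw [Measure.real, refMeasure_eq_lintegral hK]
  exact (integral_toReal (measurable_measure_prodMk_left hK).aemeasurable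
    (.of_forall fun x ↦ measure_lt_top _ _)).symm

end Measure

end ChanceConstraint

/-! ### Polynomial approximation, the penalty function and convergence. -/

namespace ChanceConstraint

open MvPolynomial

variable {n p : ℕ}

/-- Polynomials are dense in the continuous functions on a compact set. -/
lemma exists_evalAt_near {B : Set ((Fin n → ℝ) × (Fin p → ℝ))} (hB : IsCompact B)
    {F : (Fin n → ℝ) × (Fin p → ℝ) → ℝ} (hF : Continuous F) {ε : ℝ} (hε : 0 < ε) :
    ∃ f : Poly n p, ∀ z ∈ B, |evalAt f z.1 z.2 - F z| < ε := by
  let φ : Poly n p →ₐ[ℝ] C((Fin n → ℝ) × (Fin p → ℝ), ℝ) :=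
    aeval (Sum.elim (fun i ↦ ⟨fun z ↦ z.1 i, by fun_prop⟩) fun k ↦ ⟨fun z ↦ z.2 k, by fun_prop⟩)
  have hφ : ∀ f z, φ f z = evalAt f z.1 z.2 := by
    intro f z
    induction f using MvPolynomial.induction_on with
    | C a => simp [φ]
    | add f h hf hh => rw [map_add, ContinuousMap.add_apply, hf, hh, evalAt_add]
    | mul_X f i hf =>
      rw [map_mul, ContinuousMap.mul_apply, hf, evalAt_mul]
      rcases i with i | i <;> simp [φ, evalAt]
  have hsep : φ.range.SeparatesPoints := by
    intro x y hxy
    by_contra! hcon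
    have h : ∀ i, eval (Sum.elim x.1 x.2) (X i) = eval (Sum.elim y.1 y.2) (X i) := by
      intro i
      have := hcon (φ (X i)) ⟨φ (X i), ⟨X i, rfl⟩, rfl⟩
      rwa [hφ, hφ] at this
    refine hxy (Prod.ext (funext fun i ↦ ?_) (funext fun k ↦ ?_))
    · simpa using h (.inl i)
    · simpa using h (.inr k)
  obtain ⟨_, ⟨f, rfl⟩, hf⟩ :=
    ContinuousMap.exists_mem_subalgebra_near_continuous_of_isCompact_of_separatesPoints hsep
      ⟨F, hF⟩ hB hε
  refine ⟨f, fun z hz ↦ ?_⟩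
  rw [← hφ]
  exact hf z hz

/-- Squares of polynomials are dense in the nonnegative continuous functions on a compact set. -/
lemma exists_evalAt_mul_self_near {B : Set ((Fin n → ℝ) × (Fin p → ℝ))} (hB : IsCompact B)
    {F : (Fin n → ℝ) × (Fin p → ℝ) → ℝ} (hF : Continuous F) (hF0 : ∀ z, 0 ≤ F z)
    {ε : ℝ} (hε : 0 < ε) :
    ∃ f : Poly n p, ∀ z ∈ B, |evalAt (f * f) z.1 z.2 - F z| ≤ ε := by
  obtain ⟨C, hC⟩ := hB.exists_bound_of_continuousOn (hF.sqrt).continuousOn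
  set D := |C|
  have hD : 0 ≤ D := abs_nonneg C
  -- The square root is approximated. Precision `1` bounds `|f + √F|` by `2 * D + 1`, and precision
  -- `ε / (2 * D + 1)` then bounds the difference of squares by `ε`.
  obtain ⟨f, hf⟩ := exists_evalAt_near hB hF.sqrt
    (lt_min one_pos (div_pos hε (by positivity : 0 < 2 * D + 1)))
  refine ⟨f, fun z hz ↦ ?_⟩
  obtain ⟨h1, h2⟩ := lt_min_iff.1 (hf z hz)
  have h3 : √(F z) ≤ D := (le_abs_self _).trans ((hC z hz).trans (le_abs_self C))
  have h4 : √(F z) * √(F z) = F z := Real.mul_self_sqrt (hF0 z)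
  have h5 := Real.sqrt_nonneg (F z)
  set a := evalAt f z.1 z.2
  set s := √(F z)
  have h6 : |a + s| ≤ 2 * D + 1 := by
    have : a + s = (a - s) + 2 * s := by ring
    rw [this]
    refine (abs_add_le _ _).trans ?_
    rw [abs_of_nonneg (by positivity : 0 ≤ 2 * s)]
    linarith
  rw [evalAt_mul, ← h4]
  have h7 : a * a - s * s = (a - s) * (a + s) := by ring
  rw [h7, abs_mul]
  calc |a - s| * |a + s| ≤ ε / (2 * D + 1) * (2 * D + 1) := by gcongr
    _ = ε := by field_simp

section Penalty

variable {J : Type*} [Fintype J] (g : J → Poly n p)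

/-- The sum of the squares of the constraint violations. -/
noncomputable def violation (z : (Fin n → ℝ) × (Fin p → ℝ)) : ℝ :=
  ∑ j, max (-evalAt (g j) z.1 z.2) 0 ^ 2

lemma violation_nonneg (z : (Fin n → ℝ) × (Fin p → ℝ)) : 0 ≤ violation g z :=
  Finset.sum_nonneg fun _ _ ↦ sq_nonneg _

lemma continuous_violation : Continuous (violation g) :=
  continuous_finsetSum _ fun j _ ↦ ((continuous_evalAt (g j)).neg.max continuous_const).pow 2

lemma violation_eq_zero_iff (z : (Fin n → ℝ) × (Fin p → ℝ)) :
    violation g z = 0 ↔ ∀ j, 0 ≤ evalAt (g j) z.1 z.2 := by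
  rw [violation, Finset.sum_eq_zero_iff_of_nonneg fun _ _ ↦ sq_nonneg _]
  simp

/-- Since `t * max (-t) 0 = -(max (-t) 0)²`, the sum collapses to `-violation / (δ + violation)`.
The identity is a continuous analogue of a certificate, with nonnegative multipliers. -/
lemma penalty_identity {δ : ℝ} (hδ : 0 < δ) (z : (Fin n → ℝ) × (Fin p → ℝ)) :
    δ / (δ + violation g z) = 1 + ∑ j, evalAt (g j) z.1 z.2 *
      (max (-evalAt (g j) z.1 z.2) 0 / (δ + violation g z)) := by
  have hpos : 0 < δ + violation g z := add_pos_of_pos_of_nonneg hδ (violation_nonneg g z)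
  have h : ∀ t : ℝ, t * max (-t) 0 = -max (-t) 0 ^ 2 := by
    intro t
    rcases le_total (-t) 0 with ht | ht
    · simp [max_eq_right ht]
    · rw [max_eq_left ht]; ring
  simp only [← mul_div_assoc, h]
  rw [← Finset.sum_div, Finset.sum_neg_distrib]
  change _ = 1 + -violation g z / _
  field_simp
  ring

lemma continuous_div_violation {F : (Fin n → ℝ) × (Fin p → ℝ) → ℝ} (hF : Continuous F) {δ : ℝ}
    (hδ : 0 < δ) : Continuous fun z ↦ F z / (δ + violation g z) :=
  hF.div (continuous_const.add (continuous_violation g)) fun z ↦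
    (add_pos_of_pos_of_nonneg hδ (violation_nonneg g z)).ne'

variable {X : Set (Fin n → ℝ)} {Om : Set (Fin p → ℝ)} {μ : Measure (Fin p → ℝ)}
  [IsProbabilityMeasure μ]

/-- The integrand is at most `1`, equals `1` where the violation vanishes and tends to `0`
elsewhere; dominated convergence applies. -/
lemma tendsto_integral_penalty (hX : IsCompact X) (hOm : IsCompact Om) (hμ : μ.support = Om) :
    Tendsto (fun δ : ℝ ↦ ∫ z, δ / (δ + violation g z) ∂(refMeasure X μ)) (𝓝[>] 0)
      (𝓝 ((refMeasure X μ).real (feasibleSet X Om g))) := by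
  have := isFiniteMeasure_refMeasure (μ := μ) hX
  have hm := (isClosed_feasibleSet hX hOm g).measurableSet
  rw [← integral_indicator_one hm]
  refine tendsto_integral_filter_of_dominated_convergence (fun _ ↦ 1) ?_ ?_
    (integrable_const _) ?_
  · filter_upwards [self_mem_nhdsWithin] with δ hδ
    exact (continuous_div_violation g continuous_const hδ).aestronglyMeasurable
  · filter_upwards [self_mem_nhdsWithin] with δ hδ
    refine .of_forall fun z ↦ ?_
    have hδ' : 0 < δ := hδ
    have h := violation_nonneg g z
    rw [Real.norm_of_nonneg (by positivity)]
    exact div_le_one_of_le₀ (by linarith) (by positivity)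
  · filter_upwards [ae_mem_prod hX hμ] with z hz
    by_cases h0 : violation g z = 0
    · have hK : z ∈ feasibleSet X Om g := ⟨hz.1, hz.2, (violation_eq_zero_iff g z).1 h0⟩
      rw [Set.indicator_of_mem hK, Pi.one_apply]
      refine tendsto_const_nhds.congr' ?_
      filter_upwards [self_mem_nhdsWithin] with δ hδ
      rw [h0, add_zero, div_self (ne_of_gt hδ)]
    · have hK : z ∉ feasibleSet X Om g := fun h ↦ h0 ((violation_eq_zero_iff g z).2 h.2.2)
      rw [Set.indicator_of_notMem hK]
      have hc : ContinuousAt (fun δ : ℝ ↦ δ / (δ + violation g z)) 0 :=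
        continuousAt_id.div (by fun_prop) (by simpa using h0)
      have := hc.tendsto.mono_left (nhdsWithin_le_nhds (s := Set.Ioi 0))
      simpa using this

end Penalty

section Convergence

variable {J : Type*} [Fintype J] {g : J → Poly n p}
  {X : Set (Fin n → ℝ)} {Om : Set (Fin p → ℝ)} {μ : Measure (Fin p → ℝ)}
  [IsProbabilityMeasure μ]

omit [Fintype J] in
lemma MomentFeasible.mul_self_le (hX : IsCompact X) (hOm : IsCompact Om) (hμ : μ.support = Om)
    {d : ℕ} {y z : Index n p → ℝ} (h : MomentFeasible X μ g d y z) {f : Poly n p}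
    (hf : f.totalDegree ≤ d) :
    rieszLin y (f * f) ≤ ∫ z, evalAt (f * f) z.1 z.2 ∂(refMeasure X μ) := by
  obtain ⟨hsum, -, hz, -⟩ := momentFeasible_iff.1 h
  have h1 := rieszLin_add_eq hsum ((totalDegree_mul f f).trans (by omega))
  rw [rieszLin_momentProd hX hOm hμ] at h1
  linarith [hz f hf]

omit [Fintype J] in
/-- The functional of a feasible solution is controlled by the supremum over `X ×ˢ Om`. -/
lemma MomentFeasible.le_of_abs_le (hX : IsCompact X) (hOm : IsCompact Om) (hμ : μ.support = Om)
    {d : ℕ} {y z : Index n p → ℝ} (h : MomentFeasible X μ g d y z) {f : Poly n p}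
    (hf : f.totalDegree ≤ d) {ε : ℝ} (hε : 0 < ε)
    (hfε : ∀ z ∈ X ×ˢ Om, |evalAt f z.1 z.2| ≤ ε) :
    rieszLin y f ≤ ε * (refMeasure X μ).real Set.univ := by
  have := isFiniteMeasure_refMeasure (μ := μ) hX
  set V := (refMeasure X μ).real Set.univ
  obtain ⟨-, hy, -, -⟩ := momentFeasible_iff.1 h
  have h1 := h.mul_self_le hX hOm hμ hf
  have h2 : ∫ z, evalAt (f * f) z.1 z.2 ∂(refMeasure X μ) ≤ ε ^ 2 * V := by
    have : ∫ _, ε ^ 2 ∂(refMeasure X μ) = ε ^ 2 * V := by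
      rw [integral_const, smul_eq_mul, mul_comm]
    rw [← this]
    refine integral_mono_ae (integrable_refMeasure hX hOm hμ (continuous_evalAt _))
      (integrable_const _) ?_
    filter_upwards [ae_mem_prod hX hμ] with z hz
    rw [evalAt_mul, ← sq, ← sq_abs]
    gcongr
    exact hfε z hz
  have h3 := h.mul_self_le hX hOm hμ (f := 1) (by simp)
  have h4 : ∫ z, evalAt (1 * 1 : Poly n p) z.1 z.2 ∂(refMeasure X μ) = V := by
    simp [V]
  -- Expanding `0 ≤ L_y ((f - ε)²)` gives `2 ε L_y f ≤ L_y (f²) + ε² y_0`, and both terms on the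
  -- right are at most `ε² V`.
  have h5 := hy (f - C ε) ((totalDegree_sub_C_le f ε).trans hf)
  have h6 : (f - C ε) * (f - C ε) = f * f - (2 * ε) • f + ε ^ 2 • (1 : Poly n p) := by
    rw [smul_eq_C_mul, smul_eq_C_mul, map_mul, map_pow, map_ofNat]
    ring
  rw [h4, mul_one] at h3
  rw [h6, map_add, map_sub, map_smul, map_smul, smul_eq_mul, smul_eq_mul] at h5
  have h7 : ε ^ 2 * rieszLin y 1 ≤ ε ^ 2 * V := by gcongr
  have h8 : 2 * ε * rieszLin y f ≤ 2 * ε * (ε * V) := by nlinarith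
  exact le_of_mul_le_mul_left h8 (by positivity)

lemma eventually_momentFeasible_le (hX : IsCompact X) (hOm : IsCompact Om)
    (hμ : μ.support = Om) (g : J → Poly n p) {ε : ℝ} (hε : 0 < ε) :
    ∀ᶠ d : ℕ in atTop, ∀ y z, MomentFeasible X μ g d y z →
      y 0 ≤ (refMeasure X μ).real (feasibleSet X Om g) + ε := by
  have := isFiniteMeasure_refMeasure (μ := μ) hX
  set V := (refMeasure X μ).real Set.univ with hVdef
  have hV : 0 ≤ V := measureReal_nonneg
  -- The error budget is `η` for the penalty integral, `η * V` for the square `a * a` and `2 * η *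
  -- V` for the remainder `h`.
  set η := ε / (1 + 3 * V) with hη
  have hη0 : 0 < η := by positivity
  have hBc : IsCompact (X ×ˢ Om) := hX.prod hOm
  obtain ⟨δ, hδint, hδ⟩ := (((tendsto_integral_penalty g hX hOm hμ).eventually
    (gt_mem_nhds (lt_add_of_pos_right _ hη0))).and self_mem_nhdsWithin).exists
  replace hδ : 0 < δ := hδ
  have hden : ∀ z, 0 < δ + violation g z := fun z ↦
    add_pos_of_pos_of_nonneg hδ (violation_nonneg g z)
  have hFc := continuous_div_violation g (F := fun _ ↦ δ) continuous_const hδ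
  obtain ⟨a, ha⟩ := exists_evalAt_mul_self_near hBc hFc
    (fun z ↦ (div_pos hδ (hden z)).le) hη0
  have hbound : ∀ j, ∃ D, ∀ z ∈ X ×ˢ Om, |evalAt (g j) z.1 z.2| ≤ D := fun j ↦
    hBc.exists_bound_of_continuousOn (continuous_evalAt (g j)).continuousOn
  choose D hD using hbound
  -- The summand `1` keeps `S` positive when all the bounds vanish.
  set S := 1 + ∑ j, |D j| with hS
  have hS0 : 0 < S := by positivity
  have hb : ∀ j, ∃ f : Poly n p, ∀ z ∈ X ×ˢ Om, |evalAt (f * f) z.1 z.2 -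
      max (-evalAt (g j) z.1 z.2) 0 / (δ + violation g z)| ≤ η / S := fun j ↦
    exists_evalAt_mul_self_near hBc
      (continuous_div_violation g ((continuous_evalAt (g j)).neg.max continuous_const) hδ)
      (fun z ↦ div_nonneg (le_max_right _ _) (hden z).le) (by positivity)
  choose b hb using hb
  -- By `penalty_identity`, `h` would vanish on `X ×ˢ Om` if the squares approximated exactly.
  set h := 1 - a * a + ∑ j, g j * b j * b j with hh
  have hsmall : ∀ z ∈ X ×ˢ Om, |evalAt h z.1 z.2| ≤ 2 * η := by
    intro z hz
    have hid := penalty_identity g hδ z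
    set P := δ / (δ + violation g z)
    set Q : J → ℝ := fun j ↦ max (-evalAt (g j) z.1 z.2) 0 / (δ + violation g z)
    have e : evalAt h z.1 z.2 = -(evalAt (a * a) z.1 z.2 - P) +
        ∑ j, evalAt (g j) z.1 z.2 * (evalAt (b j * b j) z.1 z.2 - Q j) := by
      simp only [hh, mul_sub, Finset.sum_sub_distrib, evalAt_add, evalAt_sub, evalAt_sum,
        evalAt_one, evalAt_mul, mul_assoc] at hid ⊢
      rw [hid]
      ring
    rw [e]
    have h1 : |∑ j, evalAt (g j) z.1 z.2 * (evalAt (b j * b j) z.1 z.2 - Q j)| ≤ η := by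
      calc _ ≤ ∑ j, |evalAt (g j) z.1 z.2 * (evalAt (b j * b j) z.1 z.2 - Q j)| :=
            Finset.abs_sum_le_sum_abs _ _
        _ ≤ ∑ j, |D j| * (η / S) := by
            refine Finset.sum_le_sum fun j _ ↦ ?_
            rw [abs_mul]
            exact mul_le_mul ((hD j z hz).trans (le_abs_self _)) (hb j z hz) (abs_nonneg _)
              (abs_nonneg _)
        _ = (S - 1) * (η / S) := by rw [← Finset.sum_mul, hS, add_sub_cancel_left]
        _ ≤ S * (η / S) := by gcongr; linarith
        _ = η := by field_simp
    refine (abs_add_le _ _).trans ?_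
    rw [abs_neg]
    linarith [ha z hz]
  -- This degree admits `a`, `h` and every `b j` as test polynomials.
  filter_upwards [eventually_ge_atTop (a.totalDegree + h.totalDegree +
    ∑ j, (halfDeg (g j) + (b j).totalDegree))] with d hd y z hyz
  obtain ⟨-, -, -, hl⟩ := momentFeasible_iff.1 hyz
  have hj : ∀ j, halfDeg (g j) + (b j).totalDegree ≤ d := fun j ↦
    (Finset.single_le_sum (f := fun j ↦ halfDeg (g j) + (b j).totalDegree)
      (fun _ _ ↦ Nat.zero_le _) (Finset.mem_univ j)).trans (by omega)
  have k1 : rieszLin y h ≤ 2 * η * V :=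
    hyz.le_of_abs_le hX hOm hμ (by omega) (by positivity) hsmall
  have k2 : rieszLin y (a * a) ≤ ∫ z, evalAt (a * a) z.1 z.2 ∂(refMeasure X μ) :=
    hyz.mul_self_le hX hOm hμ (by omega)
  have k3 : ∫ z, evalAt (a * a) z.1 z.2 ∂(refMeasure X μ) ≤
      (∫ z, δ / (δ + violation g z) ∂(refMeasure X μ)) + η * V := by
    have hFi := integrable_refMeasure hX hOm hμ hFc
    have : (∫ z, δ / (δ + violation g z) ∂(refMeasure X μ)) + η * V =
        ∫ z, (δ / (δ + violation g z) + η) ∂(refMeasure X μ) := by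
      rw [integral_add hFi (integrable_const _), integral_const, smul_eq_mul, mul_comm η]
    rw [this]
    refine integral_mono_ae (integrable_refMeasure hX hOm hμ (continuous_evalAt _))
      (hFi.add (integrable_const _)) ?_
    filter_upwards [ae_mem_prod hX hμ] with z hz
    linarith [(abs_le.1 (ha z hz)).2]
  have k4 : 0 ≤ ∑ j, rieszLin y (g j * b j * b j) :=
    Finset.sum_nonneg fun j _ ↦ hl j (b j) (by have := hj j; omega) (by have := hj j; omega)
  have k5 : rieszLin y h = y 0 - rieszLin y (a * a) + ∑ j, rieszLin y (g j * b j * b j) := by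
    rw [hh, map_add, map_sub, map_sum, rieszLin_one]
  have k6 : η + 3 * η * V = ε := by
    rw [hη]; field_simp
  linarith

end Convergence

end ChanceConstraint

/-! ### Assembly of duality, marginals and convergence. -/

theorem theorem3 (n p m : ℕ)
    (X : Set (Fin n → ℝ)) (hX : IsCompact X)
    (Om : Set (Fin p → ℝ)) (hOm : IsCompact Om)
    (μ : MeasureTheory.Measure (Fin p → ℝ)) [MeasureTheory.IsProbabilityMeasure μ]
    (hμ : μ.support = Om)
    (g : Fin (m + 1) → ChanceConstraint.Poly n p)
    (M : ℝ) (hM : 0 < M)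
    (hg : g 0 = MvPolynomial.C M - ∑ i, MvPolynomial.X i ^ 2)
    (K : Set ((Fin n → ℝ) × (Fin p → ℝ)))
    (hK : K = ChanceConstraint.feasibleSet X Om g)
    (hKint : (interior K).Nonempty)
    (hKcint : (interior ((X ×ˢ Om) \ K)).Nonempty) :
    -- no duality gap
    (∀ d : ℕ, ChanceConstraint.momentValue X μ g d = ChanceConstraint.sosValue X μ g d) ∧
    -- the dual has an optimal solution
    (∀ d : ℕ, ∃ q, ChanceConstraint.IsSosOptimal X μ g d q) ∧
    -- properties of the optimal solutions `q` of the dual and of `h(x) = ∫ q(x, ω) dμ(ω)`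
    (∀ (d : ℕ) (q : ChanceConstraint.Poly n p), ChanceConstraint.IsSosOptimal X μ g d q →
      ChanceConstraint.momentValue X μ g d =
        ((∫ z, ChanceConstraint.evalAt q z.1 z.2 ∂(ChanceConstraint.refMeasure X μ) : ℝ) :
          EReal) ∧
      (∀ z ∈ K, 1 ≤ ChanceConstraint.evalAt q z.1 z.2) ∧
      ∃ h : MvPolynomial (Fin n) ℝ, h.totalDegree ≤ 2 * d ∧
        (∀ x : Fin n → ℝ, MeasureTheory.Integrable (fun w => ChanceConstraint.evalAt q x w) μ ∧
          MvPolynomial.eval x h = ∫ w, ChanceConstraint.evalAt q x w ∂μ) ∧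
        (∀ x ∈ X, μ.real (ChanceConstraint.fiber K x) ≤ MvPolynomial.eval x h) ∧
        ChanceConstraint.momentValue X μ g d =
          ((∫ x in X, MvPolynomial.eval x h : ℝ) : EReal)) ∧
    -- convergence to the value of the infinite-dimensional linear program
    Filter.Tendsto (fun d : ℕ => ChanceConstraint.momentValue X μ g d) Filter.atTop
      (nhds ((ChanceConstraint.lpValue X μ K : ENNReal) : EReal)) ∧
    ChanceConstraint.lpValue X μ K =
      ∫⁻ x in X, μ (ChanceConstraint.fiber K x) ∧
    ((ChanceConstraint.lpValue X μ K : ENNReal) : EReal) =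
      ((∫ x in X, μ.real (ChanceConstraint.fiber K x) : ℝ) : EReal) := by
  subst hK
  have hS := ChanceConstraint.strictlyFeasible_momentsOn hX hOm hμ hKint hKcint
  have hobj : ∀ q : ChanceConstraint.Poly n p, ChanceConstraint.sosObjective X μ q =
      ChanceConstraint.rieszLin (ChanceConstraint.momentProd X μ) q := fun q ↦
    (ChanceConstraint.rieszLin_momentProd hX hOm hμ q).symm
  have hfin := ChanceConstraint.isFiniteMeasure_refMeasure (μ := μ) hX
  have hm := (ChanceConstraint.isClosed_feasibleSet hX hOm g).measurableSet
  have hval : ∀ d q, ChanceConstraint.IsSosOptimal X μ g d q →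
      ChanceConstraint.momentValue X μ g d = ((ChanceConstraint.sosObjective X μ q : ℝ) : EReal) := by
    intro d q hq
    rw [hobj]
    exact hS.momentValue_eq hq.1 fun q' hq' ↦ by
      rw [← hobj, ← hobj]; exact hq.2 q' hq'
  have hex : ∀ d : ℕ, ∃ q, ChanceConstraint.IsSosOptimal X μ g d q := by
    intro d
    obtain ⟨q, hq, hmin⟩ := hS.exists_isMin d
    exact ⟨q, hq, fun q' hq' ↦ by rw [hobj, hobj]; exact hmin q' hq'⟩
  have hlp : ((ChanceConstraint.lpValue X μ (ChanceConstraint.feasibleSet X Om g) : ENNReal) :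
      EReal) = (((ChanceConstraint.refMeasure X μ).real
        (ChanceConstraint.feasibleSet X Om g) : ℝ) : EReal) := by
    rw [ChanceConstraint.lpValue_eq hX hm, Measure.real,
      EReal.coe_ennreal_toReal (measure_ne_top _ _)]
  refine ⟨fun d ↦ ?_, hex, fun d q hq ↦ ⟨hval d q hq, fun z hz ↦ hq.1.one_le hz, ?_⟩, ?_, ?_, ?_⟩
  · obtain ⟨q, hq⟩ := hex d
    rw [hval d q hq]
    refine le_antisymm (le_sInf ?_) (sInf_le ⟨q, hq.1, rfl⟩)
    rintro _ ⟨q', hq', rfl⟩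
    exact_mod_cast hq.2 q' hq'
  · obtain ⟨h, hdeg, heval⟩ := ChanceConstraint.exists_marginal hOm hμ q
    refine ⟨h, hdeg.trans hq.1.degree_le,
      fun x ↦ ⟨ChanceConstraint.integrable_evalAt_right hOm hμ q x, heval x⟩, fun x _ ↦ ?_, ?_⟩
    · rw [heval]
      exact hq.1.measureReal_fiber_le hX hOm hμ x
    · rw [hval d q hq, ChanceConstraint.sosObjective]
      simp only [heval]
      congr 1
      exact integral_prod _ (ChanceConstraint.integrable_refMeasure hX hOm hμ
        (ChanceConstraint.continuous_evalAt q))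
  · rw [hlp]
    choose q hq using hex
    simp only [fun d ↦ hval d (q d) (hq d)]
    refine (continuous_coe_real_ereal.tendsto _).comp ?_
    refine Metric.tendsto_atTop'.2 fun ε hε ↦ ?_
    obtain ⟨N, hN⟩ := eventually_atTop.1 (ChanceConstraint.eventually_momentFeasible_le hX hOm hμ g
      (half_pos hε))
    refine ⟨N, fun d hd ↦ ?_⟩
    -- The lower bound holds for every `d`, by the dual side; the upper bound holds for large `d`,
    -- by the moment side, and passes to the dual optimum since the two values agree.
    have h1 := (hq d).1.refMeasure_le hX hOm hμ
    have h2 : ChanceConstraint.momentValue X μ g d ≤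
        (((ChanceConstraint.refMeasure X μ).real (ChanceConstraint.feasibleSet X Om g) + ε / 2 : ℝ) :
          EReal) := by
      refine sSup_le ?_
      rintro _ ⟨y, z, hyz, rfl⟩
      exact_mod_cast hN d hd.le y z hyz
    rw [hval d (q d) (hq d)] at h2
    have h3 := EReal.coe_le_coe_iff.1 h2
    rw [Real.dist_eq, abs_lt]
    constructor <;> simp only [ChanceConstraint.sosObjective] at * <;> linarith
  · rw [ChanceConstraint.lpValue_eq hX hm, ChanceConstraint.refMeasure_eq_lintegral hm]
  · rw [hlp, ChanceConstraint.refMeasure_real_eq_integral hm]
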